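/- Let $A$ and $B$ be unital complex Banach algebras and let $M$ be a Banach space that is a unital Banach $A$-$B$-bimodule, with $\|am\|\le\|a\|\,\|m\|$ and $\|mb\|\le\|m\|\,\|b\|$. Let $$\mathcal T=\begin{bmatrix}A&M\\0&B\end{bmatrix}=\left\{\begin{bmatrix}a&m\\0&b\end{bmatrix}: a\in A,\ m\in M,\ b\in B\right\}$$ be the triangular Banach algebra, with matrix addition and multiplication and the norm $\left\|\begin{bmatrix}a&m\\0&b\end{bmatrix}\right\|=\|a\|+\|m\|+\|b\|$. For a unital Banach algebra $D$ and a unital Banach $D$-bimodule $X$ put $C_0(D,X)=X$ and $C_n(D,X)=D\hat\otimes\cdots\hat\otimes D\hat\otimes X$ ($n$ factors $D$, completed projective tensor product) for $n\ge1$, and let $d_n:C_{n+1}(D,X)\to C_n(D,X)$, $n\ge0$, be the bounded linear operator with $$d_n(a_1\otimes\cdots\otimes a_{n+1}\otimes x)=a_2\otimes\cdots\otimes a_{n+1}\otimes xa_1+\sum_{k=1}^{n}(-1)^k a_1\otimes\cdots\otimes a_ka_{k+1}\otimes\cdots\otimes a_{n+1}\otimes x+(-1)^{n+1}a_1\otimes\cdots\otimes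 a_n\otimes a_{n+1}x .$$ The homology groups $H_0(D,X)=C_0(D,X)/\operatorname{Im}d_0$ and $H_n(D,X)=\operatorname{Ker}d_{n-1}/\operatorname{Im}d_n$ $(n\ge1)$ are seminormed spaces with the quotient seminorms. Then for every $n\ge0$ there is an isomorphism of seminormed spaces (a linear bijection, continuous in both directions) $$H_n(\mathcal T,\mathcal T)\cong H_n(A,A)\oplus H_n(B,B).$$ -/

import Mathlib

open scoped TensorProduct

universe u v w

noncomputable section

namespace BanachHochschild

/-! ### The projective tensor powers `A ⊗̂ ⋯ ⊗̂ A ⊗̂ X` -/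

section Chains

/-- The tensor factors of the space of `n`-chains: one copy of `A` for each `i : Fin n`
(index `some i`), and one copy of `X` (index `none`). -/
abbrev Slot (A X : Type u) (n : ℕ) : Option (Fin n) → Type u
  | none => X
  | some _ => A

instance Slot.instNormedAddCommGroup (A X : Type u) [NormedAddCommGroup A] [NormedAddCommGroup X]
    (n : ℕ) : (o : Option (Fin n)) → NormedAddCommGroup (Slot A X n o)
  | none => inferInstanceAs (NormedAddCommGroup X)
  | some _ => inferInstanceAs (NormedAddCommGroup A)

instance Slot.instNormedSpace (A X : Type u) [NormedAddCommGroup A] [NormedAddCommGroup X]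
    [NormedSpace ℂ A] [NormedSpace ℂ X] (n : ℕ) :
    (o : Option (Fin n)) → NormedSpace ℂ (Slot A X n o)
  | none => inferInstanceAs (NormedSpace ℂ X)
  | some _ => inferInstanceAs (NormedSpace ℂ A)

/-- The family `(a₁, …, aₙ, x)`. -/
def slots {A X : Type u} {n : ℕ} (a : Fin n → A) (x : X) : (o : Option (Fin n)) → Slot A X n o
  | none => x
  | some i => a i

/-- The entries `(a₁, …, aₙ)` of a family `(a₁, …, aₙ, x)`. -/
def algPart {A X : Type u} {n : ℕ} (m : (o : Option (Fin n)) → Slot A X n o) : Fin n → A :=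
  fun i => m (some i)

/-- The entry `x` of a family `(a₁, …, aₙ, x)`. -/
def modPart {A X : Type u} {n : ℕ} (m : (o : Option (Fin n)) → Slot A X n o) : X :=
  m none

theorem slots_parts {A X : Type u} {n : ℕ} (m : (o : Option (Fin n)) → Slot A X n o) :
    slots (algPart m) (modPart m) = m := by
  funext o; cases o <;> rfl

theorem algPart_update_none {A X : Type u} {n : ℕ} [DecidableEq (Option (Fin n))] (m : (o : Option (Fin n)) → Slot A X n o)
    (x : Slot A X n none) : algPart (Function.update m none x) = algPart m := by
  funext i
  exact Function.update_of_ne (Option.some_ne_none i) _ _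

theorem modPart_update_none {A X : Type u} {n : ℕ} [DecidableEq (Option (Fin n))] (m : (o : Option (Fin n)) → Slot A X n o)
    (x : Slot A X n none) : modPart (Function.update m none x) = x :=
  Function.update_self _ _ _

theorem algPart_update_some {A X : Type u} {n : ℕ} [DecidableEq (Option (Fin n))] (m : (o : Option (Fin n)) → Slot A X n o) (i : Fin n)
    (a : Slot A X n (some i)) :
    algPart (Function.update m (some i) a) = Function.update (algPart m) i a := by
  funext j
  by_cases h : j = i
  · subst h
    exact (Function.update_self (some j) a m).trans (Function.update_self j a (algPart m)).symm
  · exact (Function.update_of_ne (fun e => h (Option.some.inj e)) a m).trans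
      (Function.update_of_ne (β := fun _ => A) h a (algPart m)).symm

theorem modPart_update_some {A X : Type u} {n : ℕ} [DecidableEq (Option (Fin n))] (m : (o : Option (Fin n)) → Slot A X n o) (i : Fin n)
    (a : Slot A X n (some i)) : modPart (Function.update m (some i) a) = modPart m :=
  Function.update_of_ne (Option.some_ne_none i).symm _ _

theorem slots_eq_update_some {A X : Type u} {n : ℕ} [DecidableEq (Option (Fin n))] (a : Fin n → A) (x : X) (i : Fin n)
    (c : Slot A X n (some i)) :
    (slots (Function.update a i c) x : (o : Option (Fin n)) → Slot A X n o)
      = Function.update (slots a x) (some i) c := by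
  rw [← slots_parts (Function.update (slots a x) (some i) c), algPart_update_some,
    modPart_update_some]
  rfl

theorem slots_eq_update_none {A X : Type u} {n : ℕ} [DecidableEq (Option (Fin n))] (a : Fin n → A) (x : X) (y : Slot A X n none) :
    (slots a y : (o : Option (Fin n)) → Slot A X n o) = Function.update (slots a x) none y := by
  rw [← slots_parts (Function.update (slots a x) none y), algPart_update_none,
    modPart_update_none]
  rfl

theorem continuous_algPart {A X : Type u} [NormedAddCommGroup A] [NormedAddCommGroup X] {n : ℕ} :
    Continuous (algPart : ((o : Option (Fin n)) → Slot A X n o) → Fin n → A) :=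
  continuous_pi fun i => continuous_apply (some i)

theorem continuous_modPart {A X : Type u} [NormedAddCommGroup A] [NormedAddCommGroup X] {n : ℕ} :
    Continuous (modPart : ((o : Option (Fin n)) → Slot A X n o) → X) :=
  continuous_apply (none : Option (Fin n))

theorem continuous_slots {A X : Type u} [NormedAddCommGroup A] [NormedAddCommGroup X] {n : ℕ} {Y : Type*} [TopologicalSpace Y] {f : Y → Fin n → A} {g : Y → X}
    (hf : Continuous f) (hg : Continuous g) :
    Continuous fun y => (slots (f y) (g y) : (o : Option (Fin n)) → Slot A X n o) := by
  refine continuous_pi fun o => ?_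
  cases o with
  | none => exact hg
  | some i => exact (continuous_apply i).comp hf

variable (A X : Type u) [NormedRing A] [NormedAlgebra ℂ A] [NormedAddCommGroup X] [NormedSpace ℂ X]

/-- The algebraic tensor product `A ⊗ ⋯ ⊗ A ⊗ X` (`n` factors `A`), with the projective
seminorm: `‖z‖` is the infimum of `∑ⱼ ‖a₁ʲ‖ ⋯ ‖aₙʲ‖ ‖xʲ‖` over the representations
`z = ∑ⱼ a₁ʲ ⊗ ⋯ ⊗ aₙʲ ⊗ xʲ`. -/
abbrev AlgChain (n : ℕ) : Type u := ⨂[ℂ] o, Slot A X n o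

/-- The Banach space `Cₙ(A, X) = A ⊗̂ ⋯ ⊗̂ A ⊗̂ X` of `n`-chains: the completion of the algebraic
tensor product in the projective norm. -/
abbrev Chain (n : ℕ) : Type u := UniformSpace.Completion (AlgChain A X n)

variable {A X}

/-- The elementary tensor `a₁ ⊗ ⋯ ⊗ aₙ ⊗ x` in the algebraic tensor product. -/
def algTensor {n : ℕ} (a : Fin n → A) (x : X) : AlgChain A X n :=
  PiTensorProduct.tprod ℂ (slots a x)

/-- The elementary tensor `a₁ ⊗ ⋯ ⊗ aₙ ⊗ x` in `Cₙ(A, X)`. -/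
def tensor {n : ℕ} (a : Fin n → A) (x : X) : Chain A X n :=
  ((algTensor a x : AlgChain A X n) : UniformSpace.Completion (AlgChain A X n))

/-- If the maps `p` and `q` of `(a₁, …, aₙ₊₁, x)` are such that a change of one entry changes
exactly one entry of `(p, q)`, and linearly so, then `p ⊗ q` is multilinear. -/
def multilinearOf {n : ℕ} (p : (Fin (n + 1) → A) → X → Fin n → A) (q : (Fin (n + 1) → A) → X → X)
    (hp : Continuous fun z : (Fin (n + 1) → A) × X => p z.1 z.2)
    (hq : Continuous fun z : (Fin (n + 1) → A) × X => q z.1 z.2)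
    (hx : ∀ a x, ∃ L : X →ₗ[ℂ] X, ∀ y, p a y = p a x ∧ q a y = L y)
    (ha : ∀ a x i,
      (∃ (j : Fin n) (L : A →ₗ[ℂ] A), ∀ c, p (Function.update a i c) x = Function.update (p a x) j (L c)
          ∧ q (Function.update a i c) x = q a x) ∨
      (∃ L : A →ₗ[ℂ] X, ∀ c, p (Function.update a i c) x = p a x
          ∧ q (Function.update a i c) x = L c)) :
    ContinuousMultilinearMap ℂ (Slot A X (n + 1)) (AlgChain A X n) := by
  have key : ∀ [DecidableEq (Option (Fin (n + 1)))] [DecidableEq (Option (Fin n))]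
      (m : (o : Option (Fin (n + 1))) → Slot A X (n + 1) o) (o : Option (Fin (n + 1))),
      ∃ (o' : Option (Fin n)) (L : Slot A X (n + 1) o →ₗ[ℂ] Slot A X n o'), ∀ c,
        (slots (p (algPart (Function.update m o c)) (modPart (Function.update m o c)))
          (q (algPart (Function.update m o c)) (modPart (Function.update m o c))) :
            (o : Option (Fin n)) → Slot A X n o)
          = Function.update (slots (p (algPart m) (modPart m)) (q (algPart m) (modPart m)))
            o' (L c) := by
    intro _ _ m o
    cases o with
    | none =>
      obtain ⟨L, hL⟩ := hx (algPart m) (modPart m)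
      refine ⟨none, L, fun c => ?_⟩
      rw [algPart_update_none, modPart_update_none, (hL c).1, (hL c).2]
      exact slots_eq_update_none _ _ _
    | some i =>
      rcases ha (algPart m) (modPart m) i with ⟨j, L, hL⟩ | ⟨L, hL⟩
      · refine ⟨some j, L, fun c => ?_⟩
        rw [algPart_update_some, modPart_update_some, (hL c).1, (hL c).2]
        exact slots_eq_update_some _ _ _ _
      · refine ⟨none, L, fun c => ?_⟩
        rw [algPart_update_some, modPart_update_some, (hL c).1, (hL c).2]
        exact slots_eq_update_none _ _ _
  exact
  { toFun := fun m => algTensor (p (algPart m) (modPart m)) (q (algPart m) (modPart m))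
    map_update_add' := by
      intro inst m o c c'
      obtain ⟨o', L, hL⟩ := key m o
      simp only [algTensor, hL, map_add, MultilinearMap.map_update_add]
    map_update_smul' := by
      intro inst m o t c
      obtain ⟨o', L, hL⟩ := key m o
      simp only [algTensor, hL, map_smul, MultilinearMap.map_update_smul]
    cont := by
      have h : Continuous fun m : (o : Option (Fin (n + 1))) → Slot A X (n + 1) o =>
          (algPart m, modPart m) := continuous_algPart.prodMk continuous_modPart
      exact (PiTensorProduct.tprodL ℂ).cont.comp
        (continuous_slots (hp.comp h) (hq.comp h)) }

@[simp]
theorem multilinearOf_apply {n : ℕ} (p : (Fin (n + 1) → A) → X → Fin n → A)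
    (q : (Fin (n + 1) → A) → X → X) (hp hq hx ha) (m : (o : Option (Fin (n + 1))) → Slot A X (n + 1) o) :
    multilinearOf p q hp hq hx ha m
      = algTensor (p (algPart m) (modPart m)) (q (algPart m) (modPart m)) := rfl

end Chains

/-! ### The Hochschild homology of a Banach algebra -/

section Homology

open MulOpposite

/- `A` is a unital normed algebra and `X` is a unital normed `A`-bimodule, the right action of `A`
being written as a left action of the opposite algebra `Aᵐᵒᵖ`, that is, `x a = op a • x`.
The compatibility `(a x) b = a (x b)`, i.e. `SMulCommClass A Aᵐᵒᵖ X`, makes `d ∘ d = 0`; the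
definitions do not use it. -/
variable (A X : Type u) [NormedRing A] [NormedAlgebra ℂ A] [NormedAddCommGroup X] [NormedSpace ℂ X]
  [Module A X] [Module Aᵐᵒᵖ X] [IsBoundedSMul A X] [IsBoundedSMul Aᵐᵒᵖ X]
  [IsScalarTower ℂ A X] [IsScalarTower ℂ Aᵐᵒᵖ X]

/-- `(a₁, …, aₙ₊₁, x) ↦ a₂ ⊗ ⋯ ⊗ aₙ₊₁ ⊗ x a₁`. -/
def faceFirst (n : ℕ) : ContinuousMultilinearMap ℂ (Slot A X (n + 1)) (AlgChain A X n) :=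
  multilinearOf (fun a _ => Fin.tail a) (fun a x => op (a 0) • x)
    (continuous_pi fun i => (continuous_apply i.succ).comp continuous_fst)
    ((continuous_op.comp ((continuous_apply 0).comp continuous_fst)).smul continuous_snd)
    (fun a _ => ⟨
      { toFun := fun y => op (a 0) • y
        map_add' := smul_add _
        map_smul' := fun t y => smul_comm (op (a 0)) t y },
      fun _ => ⟨rfl, rfl⟩⟩)
    (by
      intro a x i
      induction i using Fin.cases with
      | zero =>
        right
        refine ⟨
          { toFun := fun c => op c • x
            map_add' := fun c c' => by rw [op_add, add_smul]
            map_smul' := fun t c => by rw [RingHom.id_apply, op_smul, smul_assoc] },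
          fun c => ⟨Fin.tail_update_zero a c,
            congrArg (fun b => op b • x) (Function.update_self 0 c a)⟩⟩
      | succ i =>
        left
        exact ⟨i, LinearMap.id, fun c => ⟨Fin.tail_update_succ a i c,
          congrArg (fun b => op b • x) (Function.update_of_ne (Fin.succ_ne_zero i).symm c a)⟩⟩)

/-- `(a₁, …, aₙ₊₁, x) ↦ a₁ ⊗ ⋯ ⊗ aₙ ⊗ aₙ₊₁ x`. -/
def faceLast (n : ℕ) : ContinuousMultilinearMap ℂ (Slot A X (n + 1)) (AlgChain A X n) :=
  multilinearOf (fun a _ => Fin.init a) (fun a x => a (Fin.last n) • x)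
    (continuous_pi fun i => (continuous_apply i.castSucc).comp continuous_fst)
    (((continuous_apply (Fin.last n)).comp continuous_fst).smul continuous_snd)
    (fun a _ => ⟨
      { toFun := fun y => a (Fin.last n) • y
        map_add' := smul_add _
        map_smul' := fun t y => smul_comm (a (Fin.last n)) t y },
      fun _ => ⟨rfl, rfl⟩⟩)
    (by
      intro a x i
      induction i using Fin.lastCases with
      | last =>
        right
        refine ⟨
          { toFun := fun c => c • x
            map_add' := fun c c' => by rw [add_smul]
            map_smul' := fun t c => by rw [RingHom.id_apply, smul_assoc] },
          fun c => ⟨Fin.init_update_last a c,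
            congrArg (fun b => b • x) (Function.update_self (Fin.last n) c a)⟩⟩
      | cast i =>
        left
        exact ⟨i, LinearMap.id, fun c => ⟨Fin.init_update_castSucc a i c,
          congrArg (fun b => b • x) (Function.update_of_ne (Fin.castSucc_lt_last i).ne' c a)⟩⟩)

/-- `(a₁, …, aₙ₊₁, x) ↦ a₁ ⊗ ⋯ ⊗ aₖ aₖ₊₁ ⊗ ⋯ ⊗ aₙ₊₁ ⊗ x`, where `k = j + 1`, so that
`1 ≤ k ≤ n`. -/
def faceInner (n : ℕ) (j : Fin n) :
    ContinuousMultilinearMap ℂ (Slot A X (n + 1)) (AlgChain A X n) :=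
  multilinearOf (fun a _ => Fin.contractNth j.castSucc (· * ·) a) (fun _ x => x)
    (continuous_pi fun i => by
      unfold Fin.contractNth
      split_ifs <;> fun_prop)
    continuous_snd
    (fun _ _ => ⟨LinearMap.id, fun _ => ⟨rfl, rfl⟩⟩)
    (by
      intro a x i
      left
      rcases lt_trichotomy (i : ℕ) j with h | h | h
      · refine ⟨⟨i, by omega⟩, LinearMap.id, fun c => ⟨?_, rfl⟩⟩
        funext k
        simp only [Fin.contractNth, Function.update_apply, Fin.ext_iff, LinearMap.id_apply]
        grind
      · refine ⟨j, LinearMap.mulRight ℂ (a j.succ), fun c => ⟨?_, rfl⟩⟩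
        funext k
        simp only [Fin.contractNth, Function.update_apply, Fin.ext_iff, LinearMap.mulRight_apply]
        grind
      · by_cases h' : (i : ℕ) = j + 1
        · refine ⟨j, LinearMap.mulLeft ℂ (a j.castSucc), fun c => ⟨?_, rfl⟩⟩
          funext k
          simp only [Fin.contractNth, Function.update_apply, Fin.ext_iff, LinearMap.mulLeft_apply]
          grind
        · refine ⟨⟨i - 1, by omega⟩, LinearMap.id, fun c => ⟨?_, rfl⟩⟩
          funext k
          simp only [Fin.contractNth, Function.update_apply, Fin.ext_iff, LinearMap.id_apply]
          grind)

/-- The boundary operator `dₙ : Cₙ₊₁(A, X) → Cₙ(A, X)`, the bounded linear map with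
`dₙ(a₁ ⊗ ⋯ ⊗ aₙ₊₁ ⊗ x) = a₂ ⊗ ⋯ ⊗ aₙ₊₁ ⊗ x a₁
  + ∑_{k=1}^n (-1)^k a₁ ⊗ ⋯ ⊗ aₖ aₖ₊₁ ⊗ ⋯ ⊗ aₙ₊₁ ⊗ x
  + (-1)^(n+1) a₁ ⊗ ⋯ ⊗ aₙ ⊗ aₙ₊₁ x`. -/
def d (n : ℕ) : Chain A X (n + 1) →L[ℂ] Chain A X n :=
  (PiTensorProduct.liftIsometry ℂ (Slot A X (n + 1)) (AlgChain A X n)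
    (faceFirst A X n + ∑ j : Fin n, (-1 : ℂ) ^ ((j : ℕ) + 1) • faceInner A X n j
      + (-1 : ℂ) ^ (n + 1) • faceLast A X n)).completion

theorem d_tensor (n : ℕ) (a : Fin (n + 1) → A) (x : X) :
    d A X n (tensor a x) = tensor (Fin.tail a) (op (a 0) • x)
      + ∑ j : Fin n, (-1 : ℂ) ^ ((j : ℕ) + 1) • tensor (Fin.contractNth j.castSucc (· * ·) a) x
      + (-1 : ℂ) ^ (n + 1) • tensor (Fin.init a) (a (Fin.last n) • x) := by
  have h : ∀ (p : Fin n → A) (y : X), tensor p y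
      = (UniformSpace.Completion.toComplL : AlgChain A X n →L[ℂ] Chain A X n) (algTensor p y) :=
    fun _ _ => rfl
  simp only [h, ← map_smul, ← map_sum, ← map_add]
  rw [tensor, d, ContinuousLinearMap.completion_apply_coe]
  refine congrArg (UniformSpace.Completion.toComplL :
    AlgChain A X n →L[ℂ] Chain A X n) ?_
  rw [algTensor, PiTensorProduct.liftIsometry_apply_apply, PiTensorProduct.lift.tprod]
  simp only [ContinuousMultilinearMap.coe_coe, _root_.add_apply,
    _root_.sum_apply, _root_.smul_apply]
  rfl

/-- The `n`-cycles: the kernel of `Cₙ(A, X) → Cₙ₋₁(A, X)`, and all of `C₀(A, X)` for `n = 0`. -/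
def cycles : (n : ℕ) → Submodule ℂ (Chain A X n)
  | 0 => ⊤
  | n + 1 => LinearMap.ker (d A X n).toLinearMap

/-- The `n`-boundaries, i.e. the image of `dₙ : Cₙ₊₁(A, X) → Cₙ(A, X)`. -/
def boundaries (n : ℕ) : Submodule ℂ (Chain A X n) :=
  LinearMap.range (d A X n).toLinearMap

/-- The homology group `Hₙ(A, X)`: the `n`-cycles modulo the `n`-boundaries, with the quotient
seminorm. -/
abbrev Homology (n : ℕ) : Type u :=
  cycles A X n ⧸ (boundaries A X n).submoduleOf (cycles A X n)

end Homology

/-! ### The triangular Banach algebra -/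

section Triangular

open MulOpposite

/-- The triangular matrices with rows `(a, m)` and `(0, b)`. -/
@[ext]
structure Triangular (A : Type u) (M : Type v) (B : Type w) where
  a : A
  m : M
  b : B

namespace Triangular

variable {A : Type u} {M : Type v} {B : Type w} [NormedRing A] [NormedRing B]
  [NormedAddCommGroup M]

instance : Zero (Triangular A M B) := ⟨⟨0, 0, 0⟩⟩
instance : One (Triangular A M B) := ⟨⟨1, 0, 1⟩⟩
instance : Add (Triangular A M B) := ⟨fun x y => ⟨x.a + y.a, x.m + y.m, x.b + y.b⟩⟩
instance : Neg (Triangular A M B) := ⟨fun x => ⟨-x.a, -x.m, -x.b⟩⟩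
instance : Sub (Triangular A M B) := ⟨fun x y => ⟨x.a - y.a, x.m - y.m, x.b - y.b⟩⟩

/-- The norm `‖a‖ + ‖m‖ + ‖b‖`. -/
instance : Norm (Triangular A M B) := ⟨fun x => ‖x.a‖ + ‖x.m‖ + ‖x.b‖⟩

/-- Matrix multiplication: the product of `(a, m; 0, b)` and `(a', m'; 0, b')` is
`(a a', a m' + m b'; 0, b b')`. -/
instance [Module A M] [Module Bᵐᵒᵖ M] : Mul (Triangular A M B) :=
  ⟨fun x y => ⟨x.a * y.a, x.a • y.m + op y.b • x.m, x.b * y.b⟩⟩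

@[simp] theorem zero_a : (0 : Triangular A M B).a = 0 := rfl
@[simp] theorem zero_m : (0 : Triangular A M B).m = 0 := rfl
@[simp] theorem zero_b : (0 : Triangular A M B).b = 0 := rfl
@[simp] theorem one_a : (1 : Triangular A M B).a = 1 := rfl
@[simp] theorem one_m : (1 : Triangular A M B).m = 0 := rfl
@[simp] theorem one_b : (1 : Triangular A M B).b = 1 := rfl
@[simp] theorem add_a (x y : Triangular A M B) : (x + y).a = x.a + y.a := rfl
@[simp] theorem add_m (x y : Triangular A M B) : (x + y).m = x.m + y.m := rfl
@[simp] theorem add_b (x y : Triangular A M B) : (x + y).b = x.b + y.b := rfl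
@[simp] theorem neg_a (x : Triangular A M B) : (-x).a = -x.a := rfl
@[simp] theorem neg_m (x : Triangular A M B) : (-x).m = -x.m := rfl
@[simp] theorem neg_b (x : Triangular A M B) : (-x).b = -x.b := rfl
@[simp] theorem sub_a (x y : Triangular A M B) : (x - y).a = x.a - y.a := rfl
@[simp] theorem sub_m (x y : Triangular A M B) : (x - y).m = x.m - y.m := rfl
@[simp] theorem sub_b (x y : Triangular A M B) : (x - y).b = x.b - y.b := rfl

theorem norm_def (x : Triangular A M B) : ‖x‖ = ‖x.a‖ + ‖x.m‖ + ‖x.b‖ := rfl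

section Mul
variable [Module A M] [Module Bᵐᵒᵖ M]
@[simp] theorem mul_a (x y : Triangular A M B) : (x * y).a = x.a * y.a := rfl
@[simp] theorem mul_m (x y : Triangular A M B) :
    (x * y).m = x.a • y.m + op y.b • x.m := rfl
@[simp] theorem mul_b (x y : Triangular A M B) : (x * y).b = x.b * y.b := rfl
end Mul

instance : AddCommGroup (Triangular A M B) where
  add_assoc x y z := by ext <;> simp [add_assoc]
  zero_add x := by ext <;> simp
  add_zero x := by ext <;> simp
  add_comm x y := by ext <;> simp [add_comm]
  neg_add_cancel x := by ext <;> simp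
  sub_eq_add_neg x y := by ext <;> simp [sub_eq_add_neg]
  nsmul := nsmulRec
  zsmul := zsmulRec

variable [NormedAlgebra ℂ A] [NormedAlgebra ℂ B] [NormedSpace ℂ M]

instance : SMul ℂ (Triangular A M B) := ⟨fun t x => ⟨t • x.a, t • x.m, t • x.b⟩⟩

@[simp] theorem smul_a (t : ℂ) (x : Triangular A M B) : (t • x).a = t • x.a := rfl
@[simp] theorem smul_m (t : ℂ) (x : Triangular A M B) : (t • x).m = t • x.m := rfl
@[simp] theorem smul_b (t : ℂ) (x : Triangular A M B) : (t • x).b = t • x.b := rfl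

instance : Module ℂ (Triangular A M B) where
  one_smul x := by ext <;> simp
  mul_smul s t x := by ext <;> simp [mul_smul]
  smul_zero t := by ext <;> simp
  smul_add t x y := by ext <;> simp
  add_smul s t x := by ext <;> simp [add_smul]
  zero_smul x := by ext <;> simp

instance : NormedAddCommGroup (Triangular A M B) :=
  NormedAddCommGroup.ofCore (𝕜 := ℂ)
    { norm_nonneg := fun x => by rw [norm_def]; positivity
      norm_smul := fun t x => by simp only [norm_def, smul_a, smul_m, smul_b, norm_smul]; ring
      norm_triangle := fun x y => by
        simp only [norm_def, add_a, add_m, add_b]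
        linarith [norm_add_le x.a y.a, norm_add_le x.m y.m, norm_add_le x.b y.b]
      norm_eq_zero_iff := fun x => by
        constructor
        · intro h
          rw [norm_def] at h
          have ha := norm_nonneg x.a
          have hm := norm_nonneg x.m
          have hb := norm_nonneg x.b
          ext
          · exact norm_eq_zero.1 (by linarith)
          · exact norm_eq_zero.1 (by linarith)
          · exact norm_eq_zero.1 (by linarith)
        · rintro rfl
          simp [norm_def] }

instance : NormedSpace ℂ (Triangular A M B) where
  norm_smul_le t x := by
    simp only [norm_def, smul_a, smul_m, smul_b, norm_smul]
    exact le_of_eq (by ring)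

/-- The underlying Banach space is `A × M × B`, up to an equivalent norm. -/
def equivProd : Triangular A M B ≃L[ℂ] A × M × B :=
  LinearEquiv.toContinuousLinearEquivOfBounds
    { toFun := fun x => (x.a, x.m, x.b)
      invFun := fun p => ⟨p.1, p.2.1, p.2.2⟩
      map_add' := fun _ _ => rfl
      map_smul' := fun _ _ => rfl
      left_inv := fun _ => rfl
      right_inv := fun _ => rfl } 1 3
    (fun x => by
      have ha := norm_nonneg x.a
      have hm := norm_nonneg x.m
      have hb := norm_nonneg x.b
      simp only [LinearEquiv.coe_mk, LinearMap.coe_mk, AddHom.coe_mk, Prod.norm_def, norm_def,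
        one_mul, sup_le_iff]
      refine ⟨?_, ?_, ?_⟩ <;> linarith)
    (fun p => by
      have ha : ‖p.1‖ ≤ ‖p‖ := norm_fst_le p
      have hm : ‖p.2.1‖ ≤ ‖p‖ := (norm_fst_le p.2).trans (norm_snd_le p)
      have hb : ‖p.2.2‖ ≤ ‖p‖ := (norm_snd_le p.2).trans (norm_snd_le p)
      have h : ‖p.1‖ + ‖p.2.1‖ + ‖p.2.2‖ ≤ 3 * ‖p‖ := by linarith
      exact h)

instance [CompleteSpace A] [CompleteSpace B] [CompleteSpace M] :
    CompleteSpace (Triangular A M B) :=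
  (completeSpace_congr (e := (equivProd (A := A) (M := M) (B := B)).toEquiv)
    (equivProd (A := A) (M := M) (B := B)).isUniformEmbedding).2 inferInstance

variable [Module A M] [Module Bᵐᵒᵖ M] [SMulCommClass A Bᵐᵒᵖ M]

instance : Ring (Triangular A M B) where
  __ := (inferInstance : AddCommGroup (Triangular A M B))
  left_distrib x y z := by
    ext
    · simp [mul_add]
    · simp only [mul_m, add_m, add_b, smul_add, op_add, add_smul]; abel
    · simp [mul_add]
  right_distrib x y z := by
    ext
    · simp [add_mul]
    · simp only [mul_m, add_m, add_a, smul_add, add_smul]; abel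
    · simp [add_mul]
  zero_mul x := by ext <;> simp
  mul_zero x := by ext <;> simp
  mul_assoc x y z := by
    ext
    · simp [mul_assoc]
    · simp only [mul_m, mul_a, mul_b, smul_add, op_mul, mul_smul, smul_comm x.a (op z.b) y.m]
      abel
    · simp [mul_assoc]
  one_mul x := by ext <;> simp
  mul_one x := by ext <;> simp

variable [IsBoundedSMul A M] [IsBoundedSMul Bᵐᵒᵖ M]

instance : NormedRing (Triangular A M B) where
  __ := (inferInstance : NormedAddCommGroup (Triangular A M B))
  __ := (inferInstance : Ring (Triangular A M B))
  norm_mul_le x y := by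
    have h1 := norm_mul_le x.a y.a
    have h2 := norm_mul_le x.b y.b
    have h3 : ‖x.a • y.m + op y.b • x.m‖ ≤ ‖x.a‖ * ‖y.m‖ + ‖x.m‖ * ‖y.b‖ := by
      refine (norm_add_le _ _).trans (add_le_add (norm_smul_le _ _) ?_)
      rw [mul_comm]
      exact (norm_smul_le (op y.b) x.m).trans_eq (by rw [norm_op])
    simp only [norm_def, mul_a, mul_m, mul_b]
    have ha := norm_nonneg x.a
    have hm := norm_nonneg x.m
    have hb := norm_nonneg x.b
    have ha' := norm_nonneg y.a
    have hm' := norm_nonneg y.m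
    have hb' := norm_nonneg y.b
    have e1 := mul_nonneg ha hb'
    have e2 := mul_nonneg hm ha'
    have e3 := mul_nonneg hm hm'
    have e4 := mul_nonneg hb ha'
    have e5 := mul_nonneg hb hm'
    linarith

variable [IsScalarTower ℂ A M] [IsScalarTower ℂ Bᵐᵒᵖ M]

instance : NormedAlgebra ℂ (Triangular A M B) where
  __ := Algebra.ofModule
    (fun t x y => by
      ext
      · simp
      · simp only [mul_m, smul_a, smul_m, smul_add, smul_assoc, smul_comm t (op y.b) x.m]
      · simp)
    (fun t x y => by
      ext
      · simp
      · simp only [mul_m, smul_b, smul_m, smul_add, op_smul, smul_assoc, smul_comm t x.a y.m]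
      · simp)
  norm_smul_le := norm_smul_le

end Triangular

end Triangular

end BanachHochschild

end

/-! Let `e` be the idempotent `inclA A M B 1` of the triangular algebra and f = 1 - e. A chain a₁ ⊗
⋯ ⊗ aₙ ⊗ x is read as a cyclic word c₀ c₁ ⋯ cₙ with c₀ = x. The terms of `d` then all become the
same operation, the product of two neighbours on the circle.

Writing 1 = e + f on both sides of the gap between cₖ and its successor splits a word into four.
`link` keeps the two composable ones, cₖe ⊗ ecₖ₊₁ and cₖf ⊗ fcₖ₊₁. The other two can be contracted:
put e between cₖe and fcₖ₊₁; the product with the left neighbour restores the word, and the product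
with the right neighbour vanishes because ef = 0. Doing this gap by gap, each time after the earlier
gaps have been made composable, gives a bounded h with dh + hd = 1 - P, where P = `links e n (n +
1)` (`d_homotopy_zero`, `d_homotopy_succ`). Hence z - Pz is a boundary for every cycle z.

Triangularity says that fxe = 0 for all x. Along a composable word one may pass from e to f, through
M, but never back; as the word is cyclic, one never passes at all. So P sees only the two diagonal
corners of a chain (`links_eq_corners`), and a cycle z is homologous to the chain y built from its
corners, since Py = Pz. The corner projections and inclusions are bounded and multiplicative, so
they induce continuous maps on homology. Projecting after including is the identity already on
chains; including after projecting is the identity on homology because y - z is a boundary. -/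

noncomputable section

set_option linter.unusedSectionVars false

namespace BanachHochschild

/-! ### Chains as cyclic words, and bounded operators defined on words -/

section Words

variable {D : Type u} [NormedRing D] [NormedAlgebra ℂ D]
  {D' : Type v} [NormedRing D'] [NormedAlgebra ℂ D']

/-- The sequence `x, a₁, …, aₙ, 0, 0, …`. -/
def wordOf {n : ℕ} (a : Fin n → D) (x : D) : ℕ → D
  | 0 => x
  | i + 1 => if h : i < n then a ⟨i, h⟩ else 0

/-- The elementary tensor `c₁ ⊗ ⋯ ⊗ cₙ ⊗ c₀`, seen as the cyclic word `c₀ c₁ ⋯ cₙ`. -/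
def wordTensor (n : ℕ) (c : ℕ → D) : Chain D D n := tensor (fun i : Fin n => c (i + 1)) (c 0)

theorem wordTensor_wordOf {n : ℕ} (a : Fin n → D) (x : D) :
    wordTensor n (wordOf a x) = tensor a x := by
  have : (fun i : Fin n => wordOf a x (i + 1)) = a := by
    funext i
    simp [wordOf]
  rw [wordTensor, this]
  rfl

theorem wordTensor_congr {n : ℕ} {c c' : ℕ → D} (h : ∀ i ≤ n, c i = c' i) :
    wordTensor n c = wordTensor n c' := by
  have : (fun i : Fin n => c (i + 1)) = fun i : Fin n => c' (i + 1) :=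
    funext fun i => h _ (by omega)
  rw [wordTensor, wordTensor, this, h 0 (Nat.zero_le n)]

theorem slots_update_word {n : ℕ} [DecidableEq (Option (Fin n))] (c : ℕ → D) {j : ℕ} (hj : j ≤ n) :
    ∃ (o : Option (Fin n)) (e : D →ₗ[ℂ] Slot D D n o), ∀ y,
      (slots (fun i : Fin n => Function.update c j y (i + 1)) (Function.update c j y 0) :
        (o : Option (Fin n)) → Slot D D n o)
        = Function.update (slots (fun i : Fin n => c (i + 1)) (c 0)) o (e y) := by
  rcases j with _ | j
  · refine ⟨none, LinearMap.id, fun y => ?_⟩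
    rw [← slots_eq_update_none]
    rfl
  · refine ⟨some ⟨j, hj⟩, LinearMap.id, fun y => ?_⟩
    rw [← slots_eq_update_some]
    have : (fun i : Fin n => Function.update c (j + 1) y (i + 1))
        = Function.update (fun i : Fin n => c (i + 1)) ⟨j, hj⟩ y := by
      funext i
      simp [Function.update_apply, Fin.ext_iff]
    rw [this]
    rfl

theorem wordOf_update {n : ℕ} [DecidableEq (Option (Fin n))]
    (m : (o : Option (Fin n)) → Slot D D n o) (o : Option (Fin n)) :
    ∃ i ≤ n, ∃ e : Slot D D n o →ₗ[ℂ] D, ∀ y,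
      wordOf (algPart (Function.update m o y)) (modPart (Function.update m o y))
        = Function.update (wordOf (algPart m) (modPart m)) i (e y) := by
  rcases o with _ | i
  · refine ⟨0, Nat.zero_le n, LinearMap.id, fun y => ?_⟩
    rw [algPart_update_none, modPart_update_none]
    funext k
    rcases k with _ | k <;> simp [wordOf]
  · refine ⟨i + 1, i.2, LinearMap.id, fun y => ?_⟩
    rw [algPart_update_some, modPart_update_some]
    funext k
    rcases k with _ | k
    · simp [wordOf]
    · by_cases hk : k < n
      · simp [wordOf, Function.update_apply, Fin.ext_iff, hk]
      · have : k ≠ i := by omega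
        simp [wordOf, hk, this]

/-- `G` maps words of length `n + 1` to words of length `m + 1`, and a change of one entry changes
exactly one entry of the image, and linearly so. -/
structure IsMultilinearWord (n m : ℕ) (G : (ℕ → D) → ℕ → D') : Prop where
  cont : ∀ l ≤ m, Continuous fun c => G c l
  congr : ∀ c c', (∀ i ≤ n, c i = c' i) → ∀ l ≤ m, G c l = G c' l
  update : ∀ c, ∀ i ≤ n, ∃ j ≤ m, ∃ L : D →ₗ[ℂ] D', ∀ y, ∀ l ≤ m,
    G (Function.update c i y) l = Function.update (G c) j (L y) l

theorem wordTensor_eq {n : ℕ} (c : ℕ → D) : wordTensor n c =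
    (UniformSpace.Completion.toComplL : AlgChain D D n →L[ℂ] Chain D D n)
      (PiTensorProduct.tprod ℂ (slots (fun i : Fin n => c (i + 1)) (c 0))) := rfl

theorem continuous_wordOf {n : ℕ} : Continuous fun m : (o : Option (Fin n)) → Slot D D n o =>
    wordOf (algPart m) (modPart m) := by
  refine continuous_pi fun i => ?_
  rcases i with _ | i
  · exact continuous_modPart
  · by_cases h : i < n
    · simp only [wordOf, h, dite_true]
      exact continuous_apply (some (⟨i, h⟩ : Fin n))
    · simp only [wordOf, h, dite_false]
      exact continuous_const

/-- The multilinear map into chains defined by a multilinear map of words. -/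
def IsMultilinearWord.multilinear {n m : ℕ} {G : (ℕ → D) → ℕ → D'} (hG : IsMultilinearWord n m G) :
    ContinuousMultilinearMap ℂ (Slot D D n) (AlgChain D' D' m) :=
  -- A change of one slot changes one letter of the word, hence one letter of its image, hence one
  -- slot of the target, linearly at each stage.
  have key : ∀ [DecidableEq (Option (Fin n))] [DecidableEq (Option (Fin m))]
      (s : (o : Option (Fin n)) → Slot D D n o) (o : Option (Fin n)),
      ∃ (o' : Option (Fin m)) (L : Slot D D n o →ₗ[ℂ] Slot D' D' m o'), ∀ y,
        let W := fun s => G (wordOf (algPart s) (modPart s))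
        (slots (fun i : Fin m => W (Function.update s o y) (i + 1)) (W (Function.update s o y) 0) :
          (o : Option (Fin m)) → Slot D' D' m o)
          = Function.update (slots (fun i : Fin m => W s (i + 1)) (W s 0)) o' (L y) := by
    intro _ _ s o
    obtain ⟨i, hi, e, he⟩ := wordOf_update s o
    obtain ⟨j, hj, L, hL⟩ := hG.update (wordOf (algPart s) (modPart s)) i hi
    obtain ⟨o', e', he'⟩ := slots_update_word (G (wordOf (algPart s) (modPart s))) hj
    refine ⟨o', e' ∘ₗ L ∘ₗ e, fun y => ?_⟩
    have h1 : (fun l : Fin m => G (Function.update (wordOf (algPart s) (modPart s)) i (e y)) (l + 1))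
        = fun l : Fin m => Function.update (G (wordOf (algPart s) (modPart s))) j (L (e y)) (l + 1) :=
      funext fun l => hL _ _ (by omega)
    simp only [he]
    rw [h1, hL _ _ (Nat.zero_le m), he']
    rfl
  { toFun := fun s => PiTensorProduct.tprod ℂ
      (slots (fun i : Fin m => G (wordOf (algPart s) (modPart s)) (i + 1))
        (G (wordOf (algPart s) (modPart s)) 0))
    map_update_add' := by
      intro inst s o c c'
      obtain ⟨o', L, hL⟩ := key s o
      simp only [] at hL
      simp only [hL, map_add, MultilinearMap.map_update_add]
    map_update_smul' := by
      intro inst s o t c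
      obtain ⟨o', L, hL⟩ := key s o
      simp only [] at hL
      simp only [hL, map_smul, MultilinearMap.map_update_smul]
    cont := (PiTensorProduct.tprodL ℂ).cont.comp (continuous_slots
      (continuous_pi fun i => (hG.cont _ (by omega)).comp continuous_wordOf)
      ((hG.cont _ (Nat.zero_le m)).comp continuous_wordOf)) }

/-- The bounded operator on chains defined by a multilinear map of words. -/
def IsMultilinearWord.op {n m : ℕ} {G : (ℕ → D) → ℕ → D'} (hG : IsMultilinearWord n m G) :
    Chain D D n →L[ℂ] Chain D' D' m :=
  (PiTensorProduct.liftIsometry ℂ (Slot D D n) (AlgChain D' D' m) hG.multilinear).completion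

@[simp]
theorem IsMultilinearWord.op_wordTensor {n m : ℕ} {G : (ℕ → D) → ℕ → D'}
    (hG : IsMultilinearWord n m G) (c : ℕ → D) :
    hG.op (wordTensor n c) = wordTensor m (G c) := by
  -- Passing through slots replaces the letters of `c` beyond `n` by zeros, which `G` does not see.
  have h : ∀ l ≤ m, G (wordOf (fun i : Fin n => c (i + 1)) (c 0)) l = G c l := by
    refine hG.congr _ _ fun i hi => ?_
    rcases i with _ | i
    · rfl
    · simp only [wordOf, dif_pos (show i < n from hi)]
  rw [← wordTensor_congr h, wordTensor, tensor, IsMultilinearWord.op,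
    ContinuousLinearMap.completion_apply_coe, algTensor,
    PiTensorProduct.liftIsometry_apply_apply, PiTensorProduct.lift.tprod]
  rfl

/-- The algebraic tensor product is dense in its completion, and a linear map on it is determined by
its values on elementary tensors. -/
theorem chain_ext {n : ℕ} {F : Type*} [NormedAddCommGroup F] [NormedSpace ℂ F]
    {f g : Chain D D n →L[ℂ] F} (h : ∀ c : ℕ → D, f (wordTensor n c) = g (wordTensor n c)) :
    f = g := by
  ext z
  induction z using UniformSpace.Completion.induction_on with
  | hp => exact isClosed_eq f.continuous g.continuous
  | ih z =>
    have : (f ∘L UniformSpace.Completion.toComplL).toLinearMap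
        = (g ∘L UniformSpace.Completion.toComplL).toLinearMap := by
      refine PiTensorProduct.ext (MultilinearMap.ext fun s => ?_)
      have := h (wordOf (algPart s) (modPart s))
      rw [wordTensor_wordOf, tensor, algTensor, slots_parts] at this
      exact this
    exact LinearMap.congr_fun this z

theorem wordTensor_update_add {n k : ℕ} (hk : k ≤ n) (c : ℕ → D) (x y : D) :
    wordTensor n (Function.update c k (x + y))
      = wordTensor n (Function.update c k x) + wordTensor n (Function.update c k y) := by
  classical
  obtain ⟨o, e, h⟩ := slots_update_word c hk
  simp only [wordTensor_eq, h, map_add, MultilinearMap.map_update_add]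

theorem wordTensor_eq_zero {n k : ℕ} (hk : k ≤ n) {c : ℕ → D} (h0 : c k = 0) :
    wordTensor n c = 0 := by
  -- With 0 = 0 + 0 in place `k`, the tensor t satisfies t = t + t.
  have := wordTensor_update_add hk c 0 0
  rw [add_zero] at this
  rw [← Function.update_eq_self k c, h0]
  simpa using this

end Words

/-! ### Identities between faces, twists and insertions of words -/

section WordMaps

variable {D : Type u} [NormedRing D]

/-- The word obtained from `c₀ ⋯ cₙ₊₁` by multiplying `cᵢ` and its cyclic successor. -/
def faceWord (n i : ℕ) (c : ℕ → D) (l : ℕ) : D :=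
  if i ≤ n then if l < i then c l else if l = i then c i * c (i + 1) else c (l + 1)
  else if l = 0 then c (n + 1) * c 0 else c l

/-- The word obtained from `c₀ ⋯ cₙ` by replacing `cₖ` by `cₖ u` and then its cyclic
successor `y` by `v y`. -/
def twistWord (n k : ℕ) (u v : D) (c : ℕ → D) (l : ℕ) : D :=
  (if (k = n ∧ l = 0) ∨ (k ≠ n ∧ l = k + 1) then v else 1) * c l * (if l = k then u else 1)

/-- The word obtained from `c₀ ⋯ cₙ` by inserting `w` after `cₖ`. -/
def insertWord (n k : ℕ) (w : D) (c : ℕ → D) (l : ℕ) : D :=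
  if l ≤ n ∧ l ≤ k then c l else if l ≤ k + 1 then w else c (l - 1)

/-- The product is formed before the gap `k`, which thereby moves to `k - 1`. When `i = k - 1` the
product ends in cₖu, and associativity suffices. -/
theorem face_insert_twist_of_lt {n i k : ℕ} (hik : i < k) (hk : k ≤ n + 1) (u v w : D)
    (c : ℕ → D) {l : ℕ}
    (hl : l ≤ n + 1) :
    faceWord (n + 1) i (insertWord (n + 1) k w (twistWord (n + 1) k u v c)) l
      = insertWord n (k - 1) w (twistWord n (k - 1) u v (faceWord n i c)) l := by
  simp only [faceWord, insertWord, twistWord]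
  grind (splits := 30)

/-- The product is formed beyond the inserted letter, which shifts its place by one. When `i = k +
2` the product begins with vcₖ₊₁. -/
theorem face_insert_twist_of_gt {n i k : ℕ} (hik : k + 1 < i) (hi : i ≤ n + 2) (u v w : D)
    (c : ℕ → D) {l : ℕ}
    (hl : l ≤ n + 1) :
    faceWord (n + 1) i (insertWord (n + 1) k w (twistWord (n + 1) k u v c)) l
      = insertWord n k w (twistWord n k u v (faceWord n (i - 1) c)) l := by
  simp only [faceWord, insertWord, twistWord]
  grind (splits := 30)

/-- The inserted `u` is absorbed on its left: (cₖu)u = cₖu. -/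
theorem face_insert_twist_self {n k : ℕ} (hk : k ≤ n) {u : D} (hu : u * u = u) (v : D)
    (c : ℕ → D) {l : ℕ}
    (hl : l ≤ n) :
    faceWord n k (insertWord n k u (twistWord n k u v c)) l = twistWord n k u v c l := by
  simp only [faceWord, insertWord, twistWord]
  grind

/-- The inserted `u` meets vcₖ₊₁ on its right, and uv = 0. The conditional index is the place of
this product, which is 0 when the gap closes the circle. -/
theorem face_insert_twist_succ {n k : ℕ} (hk : k ≤ n) {u v : D} (hu : u * v = 0) (c : ℕ → D) :
    faceWord n (k + 1) (insertWord n k u (twistWord n k u v c)) (if k = n then 0 else k + 1) = 0 := by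
  have h : ∀ x, u * (v * x) = 0 := fun x => by rw [← mul_assoc, hu, zero_mul]
  by_cases hkn : k = n
  · subst hkn
    simp [faceWord, insertWord, twistWord, ← mul_assoc, hu]
  · have : k + 1 ≤ n := by omega
    simp [faceWord, insertWord, twistWord, hkn, this, h]

theorem face_twist_of_lt {n i j : ℕ} (hij : j < i) (hj : j < n) (u v : D) (c : ℕ → D) {l : ℕ}
    (hl : l ≤ n) :
    faceWord n i (twistWord (n + 1) j u v c) l = twistWord n j u v (faceWord n i c) l := by
  simp only [faceWord, twistWord]
  grind

theorem face_twist_of_gt {n i j : ℕ} (hij : i < j) (hj : j ≤ n) (u v : D) (c : ℕ → D) {l : ℕ}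
    (hl : l ≤ n) :
    faceWord n i (twistWord (n + 1) j u v c) l = twistWord n (j - 1) u v (faceWord n i c) l := by
  simp only [faceWord, twistWord]
  grind

/-- The result is additive in `u`, so the contributions of `e` and `1 - e` add up to the untwisted
face; see `face_link_self`. -/
theorem face_twist_self {n i : ℕ} (hi : i ≤ n) {u : D} (hu : u * u = u) (c : ℕ → D) {l : ℕ}
    (hl : l ≤ n) :
    faceWord n i (twistWord (n + 1) i u u c) l =
      Function.update (faceWord n i c) i (c i * u * c (i + 1)) l := by
  simp only [faceWord, twistWord, Function.update_apply]
  grind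

end WordMaps

/-! ### Multilinearity of the word maps -/

section WordMaps

variable {D : Type u} [NormedRing D] [NormedAlgebra ℂ D]

theorem isMultilinearWord_face (n i : ℕ) :
    IsMultilinearWord (n + 1) n (faceWord n i : (ℕ → D) → ℕ → D) where
  cont l hl := by
    unfold faceWord
    split_ifs <;> fun_prop
  congr c c' h l hl := by
    simp only [faceWord]
    grind
  update c k hk := by
    by_cases hi : i ≤ n
    · rcases lt_trichotomy k i with h | rfl | h
      · refine ⟨k, by omega, LinearMap.id, fun y l hl => ?_⟩
        simp only [faceWord, Function.update_apply, LinearMap.id_apply]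
        grind
      · refine ⟨k, by omega, LinearMap.mulRight ℂ (c (k + 1)), fun y l hl => ?_⟩
        simp only [faceWord, Function.update_apply, LinearMap.mulRight_apply]
        grind
      · by_cases h' : k = i + 1
        · refine ⟨i, by omega, LinearMap.mulLeft ℂ (c i), fun y l hl => ?_⟩
          simp only [faceWord, Function.update_apply, LinearMap.mulLeft_apply]
          grind
        · refine ⟨k - 1, by omega, LinearMap.id, fun y l hl => ?_⟩
          simp only [faceWord, Function.update_apply, LinearMap.id_apply]
          grind
    -- For `i > n` the face closes the circle: both c₀ and cₙ₊₁ enter the letter in place 0.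
    · by_cases h : k = 0
      · refine ⟨0, by omega, LinearMap.mulLeft ℂ (c (n + 1)), fun y l hl => ?_⟩
        simp only [faceWord, Function.update_apply, LinearMap.mulLeft_apply]
        grind
      · by_cases h' : k = n + 1
        · refine ⟨0, by omega, LinearMap.mulRight ℂ (c 0), fun y l hl => ?_⟩
          simp only [faceWord, Function.update_apply, LinearMap.mulRight_apply]
          grind
        · refine ⟨k, by omega, LinearMap.id, fun y l hl => ?_⟩
          simp only [faceWord, Function.update_apply, LinearMap.id_apply]
          grind

theorem isMultilinearWord_map {D' : Type v} [NormedRing D'] [NormedAlgebra ℂ D'] (n : ℕ)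
    (L : ℕ → D →L[ℂ] D') : IsMultilinearWord n n fun c l => L l (c l) where
  cont l hl := (L l).continuous.comp (continuous_apply l)
  congr c c' h l hl := by rw [h l hl]
  update c k hk := by
    refine ⟨k, hk, L k, fun y l hl => ?_⟩
    by_cases h : l = k
    · subst h
      simp
    · simp [h]

theorem isMultilinearWord_twist (n k : ℕ) (u v : D) :
    IsMultilinearWord n n (twistWord n k u v) :=
  isMultilinearWord_map n fun l => (ContinuousLinearMap.mul ℂ D).flip (if l = k then u else 1) ∘L
    ContinuousLinearMap.mul ℂ D (if (k = n ∧ l = 0) ∨ (k ≠ n ∧ l = k + 1) then v else 1)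

theorem isMultilinearWord_insert (n k : ℕ) (w : D) :
    IsMultilinearWord n (n + 1) (insertWord n k w) where
  cont l hl := by
    unfold insertWord
    split_ifs <;> fun_prop
  congr c c' h l hl := by
    simp only [insertWord]
    grind
  update c i hi := by
    by_cases h : i ≤ k
    · refine ⟨i, by omega, LinearMap.id, fun y l hl => ?_⟩
      simp only [insertWord, Function.update_apply, LinearMap.id_apply]
      grind
    · refine ⟨i + 1, by omega, LinearMap.id, fun y l hl => ?_⟩
      simp only [insertWord, Function.update_apply, LinearMap.id_apply]
      grind

end WordMaps

/-- In the application `V k i` is a face of the k-th term of h, `W k i` is that term applied to a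
face, and `q k` is the chain with its first `k` gaps made composable. Off the diagonals `V` and `W`
cancel in pairs, since raising one index by one flips the sign; the diagonal telescopes. -/
theorem sum_alternating_homotopy {G : Type*} [AddCommGroup G] [Module ℂ G] (N : ℕ)
    (V W : ℕ → ℕ → G) (q : ℕ → G)
    (hlt : ∀ k < N, ∀ i ≤ k, V (k + 1) i = W k i)
    (hself : ∀ k ≤ N, V k k = q k - q (k + 1))
    (hsucc : ∀ k ≤ N, V k (k + 1) = 0)
    (hgt : ∀ k ≤ N, ∀ i, k < i → i ≤ N → V k (i + 1) = W k i) :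
    ∑ k ∈ Finset.range (N + 1), ∑ i ∈ Finset.range (N + 2), ((-1 : ℂ) ^ (k + i)) • V k i
      + ∑ k ∈ Finset.range N, ∑ i ∈ Finset.range (N + 1), ((-1 : ℂ) ^ (k + i)) • W k i
      = q 0 - q (N + 1) := by
  -- `A k` collects the faces before the inserted letter, and `B k` those beyond it, written in
  -- terms of `W`.
  set A : ℕ → G := fun k => ∑ i ∈ Finset.range k, ((-1 : ℂ) ^ (k + i)) • V k i with hA
  set B : ℕ → G := fun k => ∑ i ∈ Finset.Ico (k + 1) (N + 1), ((-1 : ℂ) ^ (k + i)) • W k i with hB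
  have row : ∀ k ∈ Finset.range (N + 1),
      ∑ i ∈ Finset.range (N + 2), ((-1 : ℂ) ^ (k + i)) • V k i
        = (q k - q (k + 1)) + A k - B k := by
    intro k hk
    have hk : k ≤ N := by simpa [Nat.lt_succ_iff] using hk
    rw [← Finset.sum_range_add_sum_Ico _ (show k ≤ N + 2 by omega),
      Finset.sum_eq_sum_Ico_succ_bot (show k < N + 2 by omega),
      Finset.sum_eq_sum_Ico_succ_bot (show k + 1 < N + 2 by omega), hself k hk, hsucc k hk,
      show ∑ i ∈ Finset.Ico (k + 1 + 1) (N + 2), ((-1 : ℂ) ^ (k + i)) • V k i = - B k by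
        rw [hB, ← Finset.sum_neg_distrib, ← Finset.sum_Ico_add' _ _ _ 1]
        refine Finset.sum_congr rfl fun i hi => ?_
        rw [Finset.mem_Ico] at hi
        rw [hgt k hk i (by omega) (by omega), ← add_assoc, pow_succ, mul_neg_one, neg_smul]]
    rw [Even.neg_one_pow (Even.add_self k), one_smul, smul_zero]
    abel
  have col : ∀ k ∈ Finset.range N,
      ∑ i ∈ Finset.range (N + 1), ((-1 : ℂ) ^ (k + i)) • W k i = B k - A (k + 1) := by
    intro k hk
    have hk : k < N := by simpa using hk
    rw [← Finset.sum_range_add_sum_Ico _ (show k + 1 ≤ N + 1 by omega),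
      show A (k + 1) = - ∑ i ∈ Finset.range (k + 1), ((-1 : ℂ) ^ (k + i)) • W k i by
        rw [hA, ← Finset.sum_neg_distrib]
        refine Finset.sum_congr rfl fun i hi => ?_
        rw [Finset.mem_range] at hi
        rw [hlt k hk i (by omega), show k + 1 + i = k + i + 1 by omega, pow_succ, mul_neg_one,
          neg_smul]]
    abel
  -- The sums of `A` and `B` cancel up to `A 0` and `B N`, which are empty sums.
  rw [Finset.sum_congr rfl row, Finset.sum_congr rfl col, Finset.sum_sub_distrib,
    Finset.sum_add_distrib, Finset.sum_range_sub', Finset.sum_sub_distrib,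
    Finset.sum_range_succ' A, Finset.sum_range_succ B,
    show A 0 = 0 by simp [hA], show B N = 0 by simp [hB]]
  abel

/-! ### The contracting homotopy of the non-composable words -/

section Operators

variable {D : Type u} [NormedRing D] [NormedAlgebra ℂ D]

variable (D) in
/-- The `i`-th face operator on chains. -/
def face (n i : ℕ) : Chain D D (n + 1) →L[ℂ] Chain D D n := (isMultilinearWord_face n i).op

/-- The operator on chains given by `twistWord`. -/
def twist (n k : ℕ) (u v : D) : Chain D D n →L[ℂ] Chain D D n :=
  (isMultilinearWord_twist n k u v).op

/-- The operator on chains given by `insertWord` after `twistWord`. -/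
def insertTwist (n k : ℕ) (u v : D) : Chain D D n →L[ℂ] Chain D D (n + 1) :=
  (isMultilinearWord_insert n k u).op ∘L twist n k u v

@[simp] theorem face_wordTensor (n i : ℕ) (c : ℕ → D) :
    face D n i (wordTensor (n + 1) c) = wordTensor n (faceWord n i c) :=
  (isMultilinearWord_face n i).op_wordTensor c

@[simp] theorem twist_wordTensor (n k : ℕ) (u v : D) (c : ℕ → D) :
    twist n k u v (wordTensor n c) = wordTensor n (twistWord n k u v c) :=
  (isMultilinearWord_twist n k u v).op_wordTensor c

@[simp] theorem insertTwist_wordTensor (n k : ℕ) (u v : D) (c : ℕ → D) :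
    insertTwist n k u v (wordTensor n c)
      = wordTensor (n + 1) (insertWord n k u (twistWord n k u v c)) := by
  simp [insertTwist, IsMultilinearWord.op_wordTensor]

theorem d_eq_sum_face (n : ℕ) :
    d D D n = ∑ i ∈ Finset.range (n + 2), (-1 : ℂ) ^ i • face D n i := by
  refine chain_ext fun c => ?_
  rw [Finset.sum_range_succ, Finset.sum_range_succ', Finset.sum_range]
  conv_lhs => rw [wordTensor, d_tensor]
  simp only [_root_.add_apply, _root_.sum_apply, _root_.smul_apply, face_wordTensor, pow_zero,
    one_smul]
  rw [add_comm (Finset.sum _ _)]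
  refine congrArg₂ (· + ·) (congrArg₂ (· + ·) rfl (Finset.sum_congr rfl fun j _ => ?_)) ?_
  · congr 1
    rw [wordTensor]
    congr 1
    · funext l
      simp only [Fin.contractNth, faceWord]
      grind
    · simp only [faceWord]
      grind
  · rw [wordTensor]
    congr 2
    · funext l
      simp [faceWord, Fin.init]
    · simp [faceWord]

theorem face_insertTwist_of_lt {n i k : ℕ} (hik : i ≤ k) (hk : k ≤ n) (u v : D)
    (z : Chain D D (n + 1)) :
    face D (n + 1) i (insertTwist (n + 1) (k + 1) u v z) = insertTwist n k u v (face D n i z) := by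
  have : face D (n + 1) i ∘L insertTwist (n + 1) (k + 1) u v = insertTwist n k u v ∘L face D n i :=
    chain_ext fun c => by
      simp only [ContinuousLinearMap.comp_apply, insertTwist_wordTensor, face_wordTensor]
      exact wordTensor_congr fun l hl =>
        face_insert_twist_of_lt (Nat.lt_succ_of_le hik) (by omega) u v u c hl
  exact DFunLike.congr_fun this z

theorem face_insertTwist_of_gt {n i k : ℕ} (hik : k < i) (hi : i ≤ n + 1) (u v : D)
    (z : Chain D D (n + 1)) :
    face D (n + 1) (i + 1) (insertTwist (n + 1) k u v z)
      = insertTwist n k u v (face D n i z) := by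
  have : face D (n + 1) (i + 1) ∘L insertTwist (n + 1) k u v = insertTwist n k u v ∘L face D n i :=
    chain_ext fun c => by
      simp only [ContinuousLinearMap.comp_apply, insertTwist_wordTensor, face_wordTensor]
      exact wordTensor_congr fun l hl =>
        face_insert_twist_of_gt (i := i + 1) (by omega) (by omega) u v u c hl
  exact DFunLike.congr_fun this z

theorem face_insertTwist_self {n k : ℕ} (hk : k ≤ n) {u : D} (hu : u * u = u) (v : D)
    (z : Chain D D n) : face D n k (insertTwist n k u v z) = twist n k u v z := by
  have : face D n k ∘L insertTwist n k u v = twist n k u v :=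
    chain_ext fun c => by
      simp only [ContinuousLinearMap.comp_apply, insertTwist_wordTensor, face_wordTensor,
        twist_wordTensor]
      exact wordTensor_congr fun l hl => face_insert_twist_self hk hu v c hl
  exact DFunLike.congr_fun this z

theorem face_insertTwist_succ {n k : ℕ} (hk : k ≤ n) {u v : D} (huv : u * v = 0)
    (z : Chain D D n) : face D n (k + 1) (insertTwist n k u v z) = 0 := by
  have : face D n (k + 1) ∘L insertTwist n k u v = 0 :=
    chain_ext fun c => by
      simp only [ContinuousLinearMap.comp_apply, insertTwist_wordTensor, face_wordTensor,
        _root_.zero_apply]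
      exact wordTensor_eq_zero (by split_ifs <;> omega) (face_insert_twist_succ hk huv c)
  exact DFunLike.congr_fun this z

theorem face_twist_lt {n i j : ℕ} (hij : j < i) (hj : j < n) (u v : D) (z : Chain D D (n + 1)) :
    face D n i (twist (n + 1) j u v z) = twist n j u v (face D n i z) := by
  have : face D n i ∘L twist (n + 1) j u v = twist n j u v ∘L face D n i :=
    chain_ext fun c => by
      simp only [ContinuousLinearMap.comp_apply, twist_wordTensor, face_wordTensor]
      exact wordTensor_congr fun l hl => face_twist_of_lt hij hj u v c hl
  exact DFunLike.congr_fun this z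

theorem face_twist_gt {n i j : ℕ} (hij : i ≤ j) (hj : j < n) (u v : D) (z : Chain D D (n + 1)) :
    face D n i (twist (n + 1) (j + 1) u v z) = twist n j u v (face D n i z) := by
  have : face D n i ∘L twist (n + 1) (j + 1) u v = twist n j u v ∘L face D n i :=
    chain_ext fun c => by
      simp only [ContinuousLinearMap.comp_apply, twist_wordTensor, face_wordTensor]
      exact wordTensor_congr fun l hl =>
        face_twist_of_gt (Nat.lt_succ_of_le hij) (Nat.succ_le_of_lt hj) u v c hl
  exact DFunLike.congr_fun this z

/-- Only the letter in place `k` depends on the right factor, and it does so additively. -/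
theorem wordTensor_twist_add {n k : ℕ} (hk : k ≤ n) (e v : D) (c : ℕ → D) :
    wordTensor n (twistWord n k e v c) + wordTensor n (twistWord n k (1 - e) v c)
      = wordTensor n (twistWord n k 1 v c) := by
  have h : ∀ u : D, twistWord n k u v c
      = Function.update (twistWord n k 1 v c) k (twistWord n k 1 v c k * u) := fun u => by
    funext l
    simp only [twistWord, Function.update_apply]
    grind
  rw [h e, h (1 - e), ← wordTensor_update_add hk, ← mul_add, add_sub_cancel, mul_one,
    Function.update_eq_self]

theorem wordTensor_twist_add_right {n k : ℕ} (hk : k ≤ n) (e u : D) (c : ℕ → D) :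
    wordTensor n (twistWord n k u e c) + wordTensor n (twistWord n k u (1 - e) c)
      = wordTensor n (twistWord n k u 1 c) := by
  have h : ∀ v : D, twistWord n k u v c
      = Function.update (twistWord n k u 1 c) (if k = n then 0 else k + 1)
        (v * twistWord n k u 1 c (if k = n then 0 else k + 1)) := fun v => by
    funext l
    by_cases hkn : k = n
    · simp only [twistWord, Function.update_apply, hkn]
      grind
    · simp only [twistWord, Function.update_apply, hkn]
      grind
  rw [h e, h (1 - e), ← wordTensor_update_add (by split_ifs <;> omega), ← add_mul, add_sub_cancel,
    one_mul, Function.update_eq_self]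

theorem twistWord_one_one (n k : ℕ) (c : ℕ → D) : twistWord n k 1 1 c = c := by
  funext l
  simp [twistWord]

/-- The projection onto the words for which `cₖ` and its cyclic successor are composable with
respect to the idempotents `e` and `1 - e`. -/
def link (e : D) (n k : ℕ) : Chain D D n →L[ℂ] Chain D D n :=
  twist n k e e + twist n k (1 - e) (1 - e)

/-- The insertion of an idempotent between two entries which are not composable. -/
def splice (e : D) (n k : ℕ) : Chain D D n →L[ℂ] Chain D D (n + 1) :=
  insertTwist n k e (1 - e) + insertTwist n k (1 - e) e

/-- The projection onto the words which are composable at the first `k` places. -/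
def links (e : D) (n : ℕ) : ℕ → Chain D D n →L[ℂ] Chain D D n
  | 0 => ContinuousLinearMap.id ℂ _
  | k + 1 => link e n k ∘L links e n k

/-- The contracting homotopy of the words that are not composable. -/
def homotopy (e : D) (n : ℕ) : Chain D D n →L[ℂ] Chain D D (n + 1) :=
  ∑ k ∈ Finset.range (n + 1), (-1 : ℂ) ^ k • (splice e n k ∘L links e n k)

variable {e : D}

theorem face_splice_of_lt {n i k : ℕ} (hik : i ≤ k) (hk : k ≤ n) (z : Chain D D (n + 1)) :
    face D (n + 1) i (splice e (n + 1) (k + 1) z) = splice e n k (face D n i z) := by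
  simp only [splice, _root_.add_apply, map_add, face_insertTwist_of_lt hik hk]

theorem face_splice_of_gt {n i k : ℕ} (hik : k < i) (hi : i ≤ n + 1) (z : Chain D D (n + 1)) :
    face D (n + 1) (i + 1) (splice e (n + 1) k z) = splice e n k (face D n i z) := by
  simp only [splice, _root_.add_apply, map_add, face_insertTwist_of_gt hik hi]

/-- This is 1 = e + (1 - e) on both sides of the gap; `link` accounts for two of the four terms. -/
theorem twist_sum {n k : ℕ} (hk : k ≤ n) (z : Chain D D n) :
    twist n k e (1 - e) z + twist n k (1 - e) e z + link e n k z = z := by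
  have : twist n k e (1 - e) + twist n k (1 - e) e + link e n k = ContinuousLinearMap.id ℂ _ :=
    chain_ext fun c => by
      have h1 := wordTensor_twist_add_right hk e e c
      have h2 := wordTensor_twist_add_right hk e (1 - e) c
      have h3 := wordTensor_twist_add hk e 1 c
      rw [twistWord_one_one, ← h1, ← h2] at h3
      simp only [link, _root_.add_apply, twist_wordTensor, ContinuousLinearMap.id_apply]
      rw [← h3]
      abel
  exact DFunLike.congr_fun this z

theorem face_splice_self (he : e * e = e) {n k : ℕ} (hk : k ≤ n) (z : Chain D D n) :
    face D n k (splice e n k z) = z - link e n k z := by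
  have he' : (1 - e) * (1 - e) = 1 - e := IsIdempotentElem.one_sub he
  rw [splice, _root_.add_apply, map_add, face_insertTwist_self hk he,
    face_insertTwist_self hk he', eq_sub_iff_add_eq, twist_sum hk]

theorem face_splice_succ (he : e * e = e) {n k : ℕ} (hk : k ≤ n) (z : Chain D D n) :
    face D n (k + 1) (splice e n k z) = 0 := by
  rw [splice, _root_.add_apply, map_add,
    face_insertTwist_succ hk (by rw [mul_sub, he, mul_one, sub_self]),
    face_insertTwist_succ hk (by rw [sub_mul, he, one_mul, sub_self]), add_zero]

theorem face_link_of_lt {n i j : ℕ} (hij : j < i) (hj : j < n) (z : Chain D D (n + 1)) :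
    face D n i (link e (n + 1) j z) = link e n j (face D n i z) := by
  simp only [link, _root_.add_apply, map_add, face_twist_lt hij hj]

theorem face_link_of_gt {n i j : ℕ} (hij : i ≤ j) (hj : j < n) (z : Chain D D (n + 1)) :
    face D n i (link e (n + 1) (j + 1) z) = link e n j (face D n i z) := by
  simp only [link, _root_.add_apply, map_add, face_twist_gt hij hj]

/-- Multiplying across a gap forgets that it was made composable: cₑₑ-type terms give cᵢeecᵢ₊₁ +
cᵢ(1 - e)(1 - e)cᵢ₊₁ = cᵢcᵢ₊₁. -/
theorem face_link_self (he : e * e = e) {n i : ℕ} (hi : i ≤ n) (z : Chain D D (n + 1)) :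
    face D n i (link e (n + 1) i z) = face D n i z := by
  have he' : (1 - e) * (1 - e) = 1 - e := IsIdempotentElem.one_sub he
  have : face D n i ∘L link e (n + 1) i = face D n i :=
    chain_ext fun c => by
      simp only [ContinuousLinearMap.comp_apply, link, _root_.add_apply, map_add,
        twist_wordTensor, face_wordTensor]
      rw [wordTensor_congr fun l hl => face_twist_self hi he c hl,
        wordTensor_congr fun l hl => face_twist_self hi he' c hl, ← wordTensor_update_add hi,
        ← add_mul, ← mul_add, add_sub_cancel, mul_one]
      congr 1
      rw [Function.update_eq_self_iff]
      simp [faceWord, hi]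
  exact DFunLike.congr_fun this z

theorem face_links_of_le {n i k : ℕ} (hki : k ≤ i) (hk : k ≤ n) (z : Chain D D (n + 1)) :
    face D n i (links e (n + 1) k z) = links e n k (face D n i z) := by
  induction k with
  | zero => rfl
  | succ k ih =>
    simp only [links, ContinuousLinearMap.comp_apply]
    rw [face_link_of_lt (by omega) (by omega), ih (by omega) (by omega)]

/-- The face closes gap `i`, whose link it absorbs. So `k + 1` links become `k`, the later ones
moving down by one place. -/
theorem face_links_of_lt (he : e * e = e) {n i k : ℕ} (hik : i ≤ k) (hk : k ≤ n)
    (z : Chain D D (n + 1)) :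
    face D n i (links e (n + 1) (k + 1) z) = links e n k (face D n i z) := by
  induction k with
  | zero =>
    obtain rfl : i = 0 := by omega
    simp only [links, ContinuousLinearMap.comp_apply]
    rw [face_link_self he (by omega)]
    rfl
  | succ k ih =>
    rw [links, ContinuousLinearMap.comp_apply]
    rcases hik.eq_or_lt with rfl | h
    · rw [face_link_self he (by omega), face_links_of_le (by omega) (by omega)]
    · rw [face_link_of_gt (by omega) (by omega), ih (by omega) (by omega)]
      rfl

theorem d_homotopy_apply (n : ℕ) (z : Chain D D n) :
    d D D n (homotopy e n z) = ∑ k ∈ Finset.range (n + 1), ∑ i ∈ Finset.range (n + 2),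
      (-1 : ℂ) ^ (k + i) • face D n i (splice e n k (links e n k z)) := by
  simp only [homotopy, d_eq_sum_face, _root_.sum_apply, _root_.smul_apply, map_sum, map_smul,
    ContinuousLinearMap.comp_apply, Finset.smul_sum, smul_smul, pow_add]

theorem homotopy_d_apply (n : ℕ) (z : Chain D D (n + 1)) :
    homotopy e n (d D D n z) = ∑ k ∈ Finset.range (n + 1), ∑ i ∈ Finset.range (n + 2),
      (-1 : ℂ) ^ (k + i) • splice e n k (links e n k (face D n i z)) := by
  simp only [homotopy, d_eq_sum_face, _root_.sum_apply, _root_.smul_apply, map_sum, map_smul,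
    ContinuousLinearMap.comp_apply, Finset.smul_sum, smul_smul, pow_add]
  rw [Finset.sum_comm]
  simp only [mul_comm]

theorem d_homotopy_zero (he : e * e = e) (z : Chain D D 0) :
    d D D 0 (homotopy e 0 z) = z - links e 0 1 z := by
  -- In degree 0 there is no term hd: the second double sum is empty and the choice of `W` is
  -- immaterial.
  have := sum_alternating_homotopy 0 (fun k i => face D 0 i (splice e 0 k (links e 0 k z)))
    (fun _ _ => 0) (fun k => links e 0 k z) (fun k hk => absurd hk (Nat.not_lt_zero k))
    (fun k hk => face_splice_self he hk _) (fun k hk => face_splice_succ he hk _)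
    (fun k _ i h1 h2 => by omega)
  rw [d_homotopy_apply]
  simpa [links] using this

/-- The term for gap `k` is applied only after gaps 0, …, k - 1 have been linked. The diagonal faces
therefore give `links e (n + 1) k z - links e (n + 1) (k + 1) z`, which telescopes. -/
theorem d_homotopy_succ (he : e * e = e) (n : ℕ) (z : Chain D D (n + 1)) :
    d D D (n + 1) (homotopy e (n + 1) z) + homotopy e n (d D D n z)
      = z - links e (n + 1) (n + 2) z := by
  rw [d_homotopy_apply, homotopy_d_apply]
  refine sum_alternating_homotopy (n + 1)
    (fun k i => face D (n + 1) i (splice e (n + 1) k (links e (n + 1) k z)))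
    (fun k i => splice e n k (links e n k (face D n i z))) (fun k => links e (n + 1) k z)
    (fun k hk i hi => ?_) (fun k hk => face_splice_self he hk _)
    (fun k hk => face_splice_succ he hk _) (fun k hk i h1 h2 => ?_)
  · rw [face_splice_of_lt hi (by omega), face_links_of_lt he hi (by omega)]
  · rw [face_splice_of_gt h1 h2, face_links_of_le h1.le (by omega)]

end Operators

/-! ### Words with a break, and triangularity -/

section Break

variable {D : Type u} [NormedRing D] [NormedAlgebra ℂ D] {e : D}

/-- `cⱼ` ends at the idempotent `e`, where its cyclic successor in `c₀ ⋯ cₙ` does not start. -/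
def HasBreak (e : D) (n j : ℕ) (c : ℕ → D) : Prop :=
  c j * e = c j ∧ e * c (if j = n then 0 else j + 1) = 0

/-- A break at `j` concerns the right side of cⱼ and the left side of its successor; a twist at
another gap touches neither. -/
theorem HasBreak.twistWord {n j k : ℕ} {c : ℕ → D} (h : HasBreak e n j c) (hk : k ≠ j)
    (hkn : k ≤ n) (hjn : j ≤ n) (u v : D) : HasBreak e n j (twistWord n k u v c) := by
  obtain ⟨h1, h2⟩ := h
  have h3 : ∀ x, e * (c (if j = n then 0 else j + 1) * x) = 0 := fun x => by
    rw [← mul_assoc, h2, zero_mul]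
  constructor
  · simp only [BanachHochschild.twistWord, hk.symm, if_false, mul_one, mul_assoc, h1]
  · have : ¬ ((k = n ∧ (if j = n then 0 else j + 1) = 0)
        ∨ (k ≠ n ∧ (if j = n then 0 else j + 1) = k + 1)) := by
      grind
    simp only [BanachHochschild.twistWord, if_neg this, one_mul, h3]

theorem link_eq_zero_of_hasBreak {n j : ℕ} {c : ℕ → D} (h : HasBreak e n j c) (hj : j ≤ n) :
    link e n j (wordTensor n c) = 0 := by
  obtain ⟨h1, h2⟩ := h
  simp only [link, _root_.add_apply, twist_wordTensor]
  rw [wordTensor_eq_zero (k := if j = n then 0 else j + 1) (by split_ifs <;> omega),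
    wordTensor_eq_zero hj, add_zero]
  · simp [twistWord, mul_assoc, mul_sub, h1]
  · have : (j = n ∧ (if j = n then 0 else j + 1) = 0)
        ∨ (j ≠ n ∧ (if j = n then 0 else j + 1) = j + 1) := by
      split_ifs <;> omega
    simp only [twistWord, if_pos this, h2, zero_mul]

/-- The links before gap `j` preserve the break, and the link at `j` then kills the word. -/
theorem links_eq_zero_of_hasBreak {n j k : ℕ} {c : ℕ → D} (h : HasBreak e n j c) (hjk : j < k)
    (hk : k ≤ n + 1) : links e n k (wordTensor n c) = 0 := by
  -- A link turns a word into a sum of two words, so the invariant is membership in the span of the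
  -- words with a break.
  have mem : ∀ k ≤ j, links e n k (wordTensor n c)
      ∈ Submodule.span ℂ (wordTensor n '' {c | HasBreak e n j c}) := by
    intro k hkj
    induction k with
    | zero => exact Submodule.subset_span ⟨c, h, rfl⟩
    | succ k ih =>
      rw [links, ContinuousLinearMap.comp_apply]
      refine Submodule.span_induction (p := fun z _ => link e n k z ∈ _) ?_ ?_ ?_ ?_
        (ih (by omega))
      · rintro _ ⟨c, hc, rfl⟩
        simp only [link, _root_.add_apply, twist_wordTensor]
        exact add_mem
          (Submodule.subset_span ⟨_, hc.twistWord (by omega) (by omega) (by omega) _ _, rfl⟩)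
          (Submodule.subset_span ⟨_, hc.twistWord (by omega) (by omega) (by omega) _ _, rfl⟩)
      · rw [map_zero]
        exact zero_mem _
      · intro x y _ _ hx hy
        rw [map_add]
        exact add_mem hx hy
      · intro t x _ hx
        rw [map_smul]
        exact Submodule.smul_mem _ t hx
  induction k, hjk using Nat.le_induction with
  | base =>
    rw [links, ContinuousLinearMap.comp_apply]
    refine Submodule.span_induction (p := fun z _ => link e n j z = 0) ?_ ?_ ?_ ?_ (mem j le_rfl)
    · rintro _ ⟨c, hc, rfl⟩
      exact link_eq_zero_of_hasBreak hc (by omega)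
    · rw [map_zero]
    · intro x y _ _ hx hy
      rw [map_add, hx, hy, add_zero]
    · intro t x _ hx
      rw [map_smul, hx, smul_zero]
  | succ k _ ih => rw [links, ContinuousLinearMap.comp_apply, ih (by omega), map_zero]

theorem link_one_sub (n k : ℕ) : link (1 - e) n k = link e n k := by
  rw [link, link, sub_sub_cancel, add_comm]

theorem links_one_sub (n k : ℕ) : links (1 - e) n k = links e n k := by
  induction k with
  | zero => rfl
  | succ k ih => rw [links, links, ih, link_one_sub]

/-- With f = 1 - e, triangularity gives fx = fxf. So if c₀ starts with f it also ends with f, the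
part ec₁ of the next letter creates a break, and only fc₁ = fc₁f survives. The argument continues
forwards along the word. -/
theorem links_forward (he : e * e = e) (ht : ∀ x, (1 - e) * x * e = 0) (n : ℕ) (c : ℕ → D) :
    links e n (n + 1) (wordTensor n (Function.update c 0 ((1 - e) * c 0)))
      = links e n (n + 1) (wordTensor n fun l => (1 - e) * c l * (1 - e)) := by
  have he' : (1 - e) * (1 - e) = 1 - e := IsIdempotentElem.one_sub he
  have ht' : ∀ x, (1 - e) * x * (1 - e) = (1 - e) * x := fun x => by
    rw [mul_sub, ht, mul_one, sub_zero]
  have key : ∀ k ≤ n, links e n (n + 1) (wordTensor n (Function.update c 0 ((1 - e) * c 0)))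
      = links e n (n + 1) (wordTensor n fun l => if l ≤ k then (1 - e) * c l * (1 - e) else c l) := by
    intro k hk
    induction k with
    | zero =>
      congr 1
      refine wordTensor_congr fun l hl => ?_
      rcases l with _ | l <;> simp [ht']
    | succ k ih =>
      rw [ih (by omega)]
      set h : ℕ → D := fun l => if l ≤ k then (1 - e) * c l * (1 - e) else c l with hh
      have h1 : h = Function.update h (k + 1) (e * c (k + 1) + (1 - e) * c (k + 1)) := by
        rw [← add_mul, add_sub_cancel, one_mul, eq_comm, Function.update_eq_self_iff]
        simp [hh]
      have h2 : (fun l => if l ≤ k + 1 then (1 - e) * c l * (1 - e) else c l)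
          = Function.update h (k + 1) ((1 - e) * c (k + 1)) := by
        funext l
        simp only [hh, Function.update_apply, ht']
        grind
      -- Letter `k` already ends in 1 - e, and (1 - e)e = 0.
      have h3 : HasBreak (1 - e) n k (Function.update h (k + 1) (e * c (k + 1))) := by
        constructor
        · simp [hh, mul_assoc, he']
        · rw [if_neg (by omega), Function.update_self, ← mul_assoc, sub_mul, he, one_mul, sub_self,
            zero_mul]
      rw [h2, h1, wordTensor_update_add hk, map_add, ← links_one_sub,
        links_eq_zero_of_hasBreak h3 (by omega) le_rfl, zero_add, Function.update_idem]
  rw [key n le_rfl]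
  congr 1
  exact wordTensor_congr fun l hl => if_pos hl

/-- The mirror image of `links_forward`: triangularity gives xe = exe. The successor of cₙ is c₀,
which starts with e, so only cₙe = ecₙe survives; one then continues backwards down to c₀. -/
theorem links_backward (he : e * e = e) (ht : ∀ x, (1 - e) * x * e = 0) (n : ℕ) (c : ℕ → D) :
    links e n (n + 1) (wordTensor n (Function.update c 0 (e * c 0)))
      = links e n (n + 1) (wordTensor n fun l => e * c l * e) := by
  have he' : (1 - e) * (1 - e) = 1 - e := IsIdempotentElem.one_sub he
  have he0 : (1 - e) * e = 0 := by rw [sub_mul, he, one_mul, sub_self]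
  have ht' : ∀ x, x * e = e * x * e := fun x => by
    have := ht x
    rwa [sub_mul, sub_mul, one_mul, sub_eq_zero] at this
  -- `m` counts the letters already cut down, from the end of the word. The initial factor e of c₀
  -- stays in place until c₀ itself is reached.
  have key : ∀ m ≤ n + 1, links e n (n + 1) (wordTensor n (Function.update c 0 (e * c 0)))
      = links e n (n + 1) (wordTensor n fun l => if n + 1 - m ≤ l then e * c l * e
        else if l = 0 then e * c 0 else c l) := by
    intro m hm
    induction m with
    | zero =>
      congr 1
      refine wordTensor_congr fun l hl => ?_
      simp only [Function.update_apply]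
      grind
    | succ m ih =>
      rw [ih (by omega)]
      obtain ⟨k, hk⟩ : ∃ k, k = n - m := ⟨_, rfl⟩
      rw [show n + 1 - m = k + 1 by omega, show n + 1 - (m + 1) = k by omega]
      set g : ℕ → D := fun l => if k + 1 ≤ l then e * c l * e
        else if l = 0 then e * c 0 else c l with hg
      have hgk : g k * e = e * c k * e := by
        by_cases h : k = 0
        · simp [hg, h]
        · simp [hg, h, ← ht']
      have h1 : g = Function.update g k (g k * e + g k * (1 - e)) := by
        rw [← mul_add, add_sub_cancel, mul_one, Function.update_eq_self]
      have h2 : (fun l => if k ≤ l then e * c l * e else if l = 0 then e * c 0 else c l)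
          = Function.update g k (g k * e) := by
        funext l
        rw [hgk]
        simp only [hg, Function.update_apply]
        grind
      have h3 : HasBreak (1 - e) n k (Function.update g k (g k * (1 - e))) := by
        constructor
        · rw [Function.update_self, mul_assoc, he']
        -- The successor starts with e in every case: it is c₀ for the last letter (the letter
        -- itself if `n = 0`), and otherwise a letter already cut down.
        · by_cases hkn : k = n
          · by_cases h0 : k = 0
            · subst h0
              simp [← hkn, hg, ← mul_assoc, he0]
            · rw [if_pos hkn, Function.update_of_ne (Ne.symm h0)]
              simp [hg, ← mul_assoc, he0]
          · rw [if_neg hkn, Function.update_of_ne (by omega)]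
            simp [hg, ← mul_assoc, he0]
      rw [h2, h1, wordTensor_update_add (by omega), map_add, ← links_one_sub,
        links_eq_zero_of_hasBreak h3 (by omega) le_rfl, add_zero, Function.update_idem, ← h1]
  rw [key (n + 1) le_rfl]
  simp

/-- If the algebra is triangular with respect to `e` and `1 - e`, the composable cyclic words are
those with all entries in one of the diagonal corners. -/
theorem links_eq_corners (he : e * e = e) (ht : ∀ x, (1 - e) * x * e = 0) (n : ℕ) (c : ℕ → D) :
    links e n (n + 1) (wordTensor n c)
      = links e n (n + 1) (wordTensor n (fun l => e * c l * e)
        + wordTensor n fun l => (1 - e) * c l * (1 - e)) := by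
  rw [map_add, ← links_forward he ht, ← links_backward he ht, ← map_add,
    ← wordTensor_update_add (Nat.zero_le n), ← add_mul, add_sub_cancel, one_mul,
    Function.update_eq_self]

end Break

/-! ### Maps induced on chains and homology -/

section Functoriality

variable {D : Type u} [NormedRing D] [NormedAlgebra ℂ D]
  {D' : Type v} [NormedRing D'] [NormedAlgebra ℂ D']

/-- The map on chains induced by a bounded linear map. -/
def mapChain (φ : D →L[ℂ] D') (n : ℕ) : Chain D D n →L[ℂ] Chain D' D' n :=
  (isMultilinearWord_map n fun _ => φ).op

@[simp] theorem mapChain_wordTensor (φ : D →L[ℂ] D') (n : ℕ) (c : ℕ → D) :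
    mapChain φ n (wordTensor n c) = wordTensor n fun l => φ (c l) :=
  (isMultilinearWord_map n fun _ => φ).op_wordTensor c

variable {φ : D →L[ℂ] D'}

/-- Faces involve only products, so φ need not preserve the unit. This matters because the corner
inclusions are not unital. -/
theorem face_mapChain (hφ : ∀ x y, φ (x * y) = φ x * φ y) (n i : ℕ) (z : Chain D D (n + 1)) :
    face D' n i (mapChain φ (n + 1) z) = mapChain φ n (face D n i z) := by
  have : face D' n i ∘L mapChain φ (n + 1) = mapChain φ n ∘L face D n i :=
    chain_ext fun c => by
      simp only [ContinuousLinearMap.comp_apply, mapChain_wordTensor, face_wordTensor]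
      refine wordTensor_congr fun l hl => ?_
      simp only [faceWord]
      split_ifs <;> simp only [hφ]
  exact DFunLike.congr_fun this z

theorem d_mapChain (hφ : ∀ x y, φ (x * y) = φ x * φ y) (n : ℕ) (z : Chain D D (n + 1)) :
    d D' D' n (mapChain φ (n + 1) z) = mapChain φ n (d D D n z) := by
  simp only [d_eq_sum_face, _root_.sum_apply, _root_.smul_apply, map_sum, map_smul,
    face_mapChain hφ]

theorem mapChain_mem_cycles (hφ : ∀ x y, φ (x * y) = φ x * φ y) {n : ℕ} {z : Chain D D n}
    (hz : z ∈ cycles D D n) : mapChain φ n z ∈ cycles D' D' n := by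
  rcases n with _ | n
  · trivial
  · have hz : d D D n z = 0 := hz
    change d D' D' n _ = 0
    rw [d_mapChain hφ, hz, map_zero]

theorem mapChain_mem_boundaries (hφ : ∀ x y, φ (x * y) = φ x * φ y) {n : ℕ} {z : Chain D D n}
    (hz : z ∈ boundaries D D n) : mapChain φ n z ∈ boundaries D' D' n := by
  obtain ⟨y, rfl⟩ := hz
  exact ⟨mapChain φ (n + 1) y, d_mapChain hφ n y⟩

/-- The map on homology induced by a bounded multiplicative linear map. -/
def mapHomology (φ : D →L[ℂ] D') (hφ : ∀ x y, φ (x * y) = φ x * φ y) (n : ℕ) :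
    Homology D D n →L[ℂ] Homology D' D' n :=
  Submodule.liftQL _
    (Submodule.mkQL _ ∘L (mapChain φ n ∘L (cycles D D n).subtypeL).codRestrict (cycles D' D' n)
      fun z => mapChain_mem_cycles hφ z.2)
    (by
      intro z hz
      refine (Submodule.Quotient.mk_eq_zero _).2 ?_
      exact mapChain_mem_boundaries hφ hz)

theorem mapHomology_mk (hφ : ∀ x y, φ (x * y) = φ x * φ y) (n : ℕ) (z : cycles D D n) :
    mapHomology φ hφ n (Submodule.Quotient.mk z)
      = Submodule.Quotient.mk ⟨mapChain φ n z, mapChain_mem_cycles hφ z.2⟩ := rfl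

theorem mk_eq_mk_iff {n : ℕ} {x y : cycles D D n} :
    (Submodule.Quotient.mk x : Homology D D n) = Submodule.Quotient.mk y
      ↔ (x - y : Chain D D n) ∈ boundaries D D n :=
  Submodule.Quotient.eq _

end Functoriality

/-! ### Cycles are homologous to their composable parts -/

section Comparison

variable {D : Type u} [NormedRing D] [NormedAlgebra ℂ D] {e : D}

theorem sub_links_mem_boundaries (he : e * e = e) {n : ℕ} {z : Chain D D n}
    (hz : z ∈ cycles D D n) : z - links e n (n + 1) z ∈ boundaries D D n := by
  rcases n with _ | n
  · exact ⟨homotopy e 0 z, d_homotopy_zero he z⟩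
  · have hz : d D D n z = 0 := hz
    refine ⟨homotopy e (n + 1) z, ?_⟩
    have := d_homotopy_succ he n z
    rwa [hz, map_zero, add_zero] at this

end Comparison

/-! ### The corners of the triangular algebra and the isomorphism -/

namespace Triangular

variable {A : Type u} {M : Type v} {B : Type w} [NormedRing A] [NormedRing B]
  [NormedAddCommGroup M] [NormedAlgebra ℂ A] [NormedAlgebra ℂ B] [NormedSpace ℂ M]

variable (A M B) in
/-- The projection onto the upper left corner. -/
def projA : Triangular A M B →L[ℂ] A :=
  ContinuousLinearMap.fst ℂ A (M × B) ∘L (equivProd : Triangular A M B ≃L[ℂ] A × M × B)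

variable (A M B) in
/-- The projection onto the lower right corner. -/
def projB : Triangular A M B →L[ℂ] B :=
  ContinuousLinearMap.snd ℂ M B ∘L ContinuousLinearMap.snd ℂ A (M × B) ∘L
    (equivProd : Triangular A M B ≃L[ℂ] A × M × B)

variable (A M B) in
/-- The inclusion of the upper left corner. -/
def inclA : A →L[ℂ] Triangular A M B :=
  (equivProd : Triangular A M B ≃L[ℂ] A × M × B).symm ∘L ContinuousLinearMap.inl ℂ A (M × B)

variable (A M B) in
/-- The inclusion of the lower right corner. -/
def inclB : B →L[ℂ] Triangular A M B :=
  (equivProd : Triangular A M B ≃L[ℂ] A × M × B).symm ∘L ContinuousLinearMap.inr ℂ A (M × B) ∘L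
    ContinuousLinearMap.inr ℂ M B

theorem projA_apply (x : Triangular A M B) : projA A M B x = x.a := rfl
theorem projB_apply (x : Triangular A M B) : projB A M B x = x.b := rfl
theorem inclA_apply (a : A) : inclA A M B a = ⟨a, 0, 0⟩ := rfl
theorem inclB_apply (b : B) : inclB A M B b = ⟨0, 0, b⟩ := rfl

variable [Module A M] [Module Bᵐᵒᵖ M] [SMulCommClass A Bᵐᵒᵖ M]
  [IsScalarTower ℂ A M] [IsScalarTower ℂ Bᵐᵒᵖ M] [IsBoundedSMul A M] [IsBoundedSMul Bᵐᵒᵖ M]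

theorem projA_mul (x y : Triangular A M B) :
    projA A M B (x * y) = projA A M B x * projA A M B y := rfl

theorem projB_mul (x y : Triangular A M B) :
    projB A M B (x * y) = projB A M B x * projB A M B y := rfl

theorem inclA_mul (x y : A) : inclA A M B (x * y) = inclA A M B x * inclA A M B y := by
  ext <;> simp [inclA_apply]

theorem inclB_mul (x y : B) : inclB A M B (x * y) = inclB A M B x * inclB A M B y := by
  ext <;> simp [inclB_apply]

theorem one_sub_inclA_one : 1 - inclA A M B 1 = inclB A M B 1 := by
  ext <;> simp [inclA_apply, inclB_apply]

theorem corner_a (x : Triangular A M B) :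
    inclA A M B 1 * x * inclA A M B 1 = inclA A M B (projA A M B x) := by
  ext <;> simp [inclA_apply, projA_apply]

theorem corner_b (x : Triangular A M B) :
    inclB A M B 1 * x * inclB A M B 1 = inclB A M B (projB A M B x) := by
  ext <;> simp [inclB_apply, projB_apply]

theorem corner_ba (x : Triangular A M B) : inclB A M B 1 * x * inclA A M B 1 = 0 := by
  ext <;> simp [inclA_apply, inclB_apply]

theorem mapChain_projA_inclA (n : ℕ) (z : Chain A A n) :
    mapChain (projA A M B) n (mapChain (inclA A M B) n z) = z := by
  have : mapChain (projA A M B) n ∘L mapChain (inclA A M B) n = ContinuousLinearMap.id ℂ _ :=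
    chain_ext fun c => by simp [projA_apply, inclA_apply]
  exact DFunLike.congr_fun this z

theorem mapChain_projB_inclB (n : ℕ) (z : Chain B B n) :
    mapChain (projB A M B) n (mapChain (inclB A M B) n z) = z := by
  have : mapChain (projB A M B) n ∘L mapChain (inclB A M B) n = ContinuousLinearMap.id ℂ _ :=
    chain_ext fun c => by simp [projB_apply, inclB_apply]
  exact DFunLike.congr_fun this z

theorem mapChain_projA_inclB (n : ℕ) (z : Chain B B n) :
    mapChain (projA A M B) n (mapChain (inclB A M B) n z) = 0 := by
  have : mapChain (projA A M B) n ∘L mapChain (inclB A M B) n = 0 :=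
    chain_ext fun c => by
      simpa [projA_apply, inclB_apply] using wordTensor_eq_zero (Nat.zero_le n) rfl
  exact DFunLike.congr_fun this z

theorem mapChain_projB_inclA (n : ℕ) (z : Chain A A n) :
    mapChain (projB A M B) n (mapChain (inclA A M B) n z) = 0 := by
  have : mapChain (projB A M B) n ∘L mapChain (inclA A M B) n = 0 :=
    chain_ext fun c => by
      simpa [projB_apply, inclA_apply] using wordTensor_eq_zero (Nat.zero_le n) rfl
  exact DFunLike.congr_fun this z

/-- This is `links_eq_corners` with the corners exe and (1 - e)x(1 - e) expressed through the
projections and inclusions. -/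
theorem links_corners (n : ℕ) (z : Chain (Triangular A M B) (Triangular A M B) n) :
    links (inclA A M B 1) n (n + 1) (mapChain (inclA A M B) n (mapChain (projA A M B) n z)
      + mapChain (inclB A M B) n (mapChain (projB A M B) n z))
      = links (inclA A M B 1) n (n + 1) z := by
  have : links (inclA A M B 1) n (n + 1) ∘L
      (mapChain (inclA A M B) n ∘L mapChain (projA A M B) n
        + mapChain (inclB A M B) n ∘L mapChain (projB A M B) n)
      = links (inclA A M B 1) n (n + 1) :=
    chain_ext fun c => by
      rw [links_eq_corners (by rw [← inclA_mul, one_mul])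
        (by rw [one_sub_inclA_one]; exact corner_ba), one_sub_inclA_one]
      simp only [corner_a, corner_b, ContinuousLinearMap.comp_apply, _root_.add_apply,
        mapChain_wordTensor]
  exact DFunLike.congr_fun this z

/-- The homology of the triangular algebra is the sum of the homologies of its corners. -/
def homologyEquiv (n : ℕ) :
    Homology (Triangular A M B) (Triangular A M B) n ≃L[ℂ] Homology A A n × Homology B B n :=
  ContinuousLinearEquiv.equivOfInverse
    ((mapHomology (projA A M B) projA_mul n).prod (mapHomology (projB A M B) projB_mul n))
    ((mapHomology (inclA A M B) inclA_mul n).coprod (mapHomology (inclB A M B) inclB_mul n))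
    (by
      intro x
      obtain ⟨z, rfl⟩ := Submodule.Quotient.mk_surjective _ x
      simp only [ContinuousLinearMap.prod_apply, ContinuousLinearMap.coprod_apply, mapHomology_mk]
      rw [← Submodule.Quotient.mk_add, mk_eq_mk_iff]
      set y := mapChain (inclA A M B) n (mapChain (projA A M B) n z)
        + mapChain (inclB A M B) n (mapChain (projB A M B) n z) with hy
      have he : inclA A M B 1 * inclA A M B 1 = inclA A M B 1 := by rw [← inclA_mul, one_mul]
      have hyc : y ∈ cycles (Triangular A M B) (Triangular A M B) n :=
        add_mem (mapChain_mem_cycles inclA_mul (mapChain_mem_cycles projA_mul z.2))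
          (mapChain_mem_cycles inclB_mul (mapChain_mem_cycles projB_mul z.2))
      -- Both y - Py and z - Pz are boundaries, and Py = Pz, so their difference y - z is a
      -- boundary.
      have := sub_mem (sub_links_mem_boundaries he hyc) (sub_links_mem_boundaries he z.2)
      rw [hy, links_corners, sub_sub_sub_cancel_right] at this
      exact this)
    (by
      rintro ⟨x, y⟩
      obtain ⟨x, rfl⟩ := Submodule.Quotient.mk_surjective _ x
      obtain ⟨y, rfl⟩ := Submodule.Quotient.mk_surjective _ y
      simp only [ContinuousLinearMap.prod_apply, ContinuousLinearMap.coprod_apply, mapHomology_mk,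
        map_add, mapChain_projA_inclA, mapChain_projB_inclB, mapChain_projA_inclB,
        mapChain_projB_inclA]
      refine Prod.ext ?_ ?_
      · rw [Prod.fst_add, ← Submodule.Quotient.mk_add, mk_eq_mk_iff]
        simp
      · rw [Prod.snd_add, ← Submodule.Quotient.mk_add, mk_eq_mk_iff]
        simp)

end Triangular

end BanachHochschild

end

theorem corollary3p4
    {A : Type u} [NormedRing A] [NormedAlgebra ℂ A] [CompleteSpace A]
    {B : Type v} [NormedRing B] [NormedAlgebra ℂ B] [CompleteSpace B]
    {M : Type w} [NormedAddCommGroup M] [NormedSpace ℂ M] [CompleteSpace M]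
    [Module A M] [Module Bᵐᵒᵖ M] [SMulCommClass A Bᵐᵒᵖ M]
    [IsScalarTower ℂ A M] [IsScalarTower ℂ Bᵐᵒᵖ M]
    [IsBoundedSMul A M] [IsBoundedSMul Bᵐᵒᵖ M] (n : ℕ) :
    Nonempty
      (BanachHochschild.Homology (BanachHochschild.Triangular A M B)
          (BanachHochschild.Triangular A M B) n
        ≃L[ℂ] BanachHochschild.Homology A A n × BanachHochschild.Homology B B n) :=
  ⟨BanachHochschild.Triangular.homologyEquiv n⟩
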